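/- All graphs are finite and simple. For graphs $G_1,G_2$ on $n$ vertices with adjacency eigenvalues (counted with multiplicity) $\lambda_1(G_i)\ge\lambda_2(G_i)\ge\dots\ge\lambda_n(G_i)$, $i=1,2$, let $\sigma(G_1,G_2)=\sum_{i=1}^n|\lambda_i(G_1)-\lambda_i(G_2)|$ be their spectral distance. Let $P_n$ and $C_n$ be the path and the cycle on $n$ vertices. For a vertex $u$ of $G$ and a vertex $v$ of $H$, the coalescence of $G$ and $H$ at $u$ and $v$ is obtained from the disjoint union of $G$ and $H$ by identifying $u$ with $v$. Let $Z_n$ ($n\ge 4$) be the coalescence of $P_{n-2}$ and $P_3$ at an end vertex of $P_{n-2}$ and the vertex of degree $2$ of $P_3$. Let $W_n$ ($n\ge 6$) be the coalescence of $Z_{n-2}$ and $P_3$ at the other end vertex of the path $P_{n-4}$ from which $Z_{n-2}$ was formed (for $n\ge 7$ this is the vertex of degree $1$ of $Z_{n-2}$ that is adjacent to a vertex of degree $2$) and the vertex of degree $2$ of $P_3$. Then all of the following limits exist, and: 1. $\displaystyle\lim_{n\to\infty}\sigma(C_{2n},Z_{2n})=2$; 2. $\displaystyle\lim_{n\to\infty}\sigma(P_n,Z_n)=\frac{8-8\sqrt2+2\pi}{\pi}\approx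 0.945$; 3. $\displaystyle\lim_{n\to\infty}\sigma(W_n,Z_n)=\frac{8-8\sqrt2+2\pi}{\pi}\approx 0.945$; 4. $\displaystyle\lim_{n\to\infty}\sigma(P_n,Z_n)=\lim_{n\to\infty}\sigma(W_n,Z_n)=\tfrac12\lim_{n\to\infty}\sigma(P_n,W_n)=\frac{8-8\sqrt2+2\pi}{\pi}\approx 0.945$. Here "$\approx 0.945$" means that the value differs from $0.945$ by less than $0.0005$. -/

import Mathlib

open Filter Topology

noncomputable section

/-- The coalescence of `G` and `H`, obtained from their disjoint union by identifying the vertex `u`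
of `G` with the vertex `v` of `H`. The vertices are those of `G` (among them the merged vertex,
represented by `u`) and those of `H` other than `v`. -/
def coalescence {V W : Type} (G : SimpleGraph V) (u : V) (H : SimpleGraph W) (v : W) :
    SimpleGraph (V ⊕ {w : W // w ≠ v}) where
  Adj x y :=
    match x, y with
    | Sum.inl a, Sum.inl b => G.Adj a b
    | Sum.inl a, Sum.inr b => a = u ∧ H.Adj v b
    | Sum.inr a, Sum.inl b => b = u ∧ H.Adj v a
    | Sum.inr a, Sum.inr b => H.Adj a b
  symm := ⟨by
    rintro (a | a) (b | b) h
    · exact h.symm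
    · exact h
    · exact h
    · exact h.symm⟩
  loopless := ⟨by
    rintro (a | a) h
    · exact G.loopless.irrefl a h
    · exact H.loopless.irrefl a.1 h⟩

/-- The vertex set of `zGraph n`. -/
abbrev ZVertex (n : ℕ) : Type := Fin (n - 2) ⊕ {w : Fin 3 // w ≠ 1}

/-- The graph `Z_n` on `n ≥ 4` vertices: the coalescence of `P_{n-2}` and `P_3` at an end vertex of
`P_{n-2}` and the vertex of degree 2 of `P_3`. -/
def zGraph (n : ℕ) (hn : 4 ≤ n) : SimpleGraph (ZVertex n) :=
  coalescence (SimpleGraph.pathGraph (n - 2)) ⟨0, by omega⟩ (SimpleGraph.pathGraph 3) 1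

/-- The vertex set of `wGraph n`. -/
abbrev WVertex (n : ℕ) : Type := ZVertex (n - 2) ⊕ {w : Fin 3 // w ≠ 1}

/-- The graph `W_n` on `n ≥ 6` vertices: the coalescence of `Z_{n-2}` and `P_3` at the other end
vertex of the path `P_{n-4}` from which `Z_{n-2}` was formed (for `n ≥ 7`, this is the vertex of
degree 1 of `Z_{n-2}` adjacent to a vertex of degree 2) and the vertex of degree 2 of `P_3`. -/
def wGraph (n : ℕ) (hn : 6 ≤ n) : SimpleGraph (WVertex n) :=
  coalescence (zGraph (n - 2) (by omega)) (Sum.inl ⟨n - 5, by omega⟩) (SimpleGraph.pathGraph 3) 1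

theorem card_compl_center : Fintype.card {w : Fin 3 // w ≠ 1} = 2 := by decide

theorem card_ZVertex (n : ℕ) (hn : 4 ≤ n) : Fintype.card (ZVertex n) = n := by
  rw [Fintype.card_sum, card_compl_center, Fintype.card_fin]; omega

theorem card_WVertex (n : ℕ) (hn : 6 ≤ n) : Fintype.card (WVertex n) = n := by
  rw [Fintype.card_sum, card_compl_center, card_ZVertex _ (by omega)]; omega

open Classical in
/-- The eigenvalues of the adjacency matrix of `G`, with multiplicity, in non-increasing order. -/
def adjEigenvalues {V : Type} [Fintype V] (G : SimpleGraph V) : Fin (Fintype.card V) → ℝ :=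
  Matrix.IsHermitian.eigenvalues₀ (A := G.adjMatrix ℝ)
    (by rw [Matrix.IsHermitian, Matrix.conjTranspose_eq_transpose_of_trivial]
        exact G.transpose_adjMatrix)

/-- The spectral distance `∑ i, |λ_i(G) - λ_i(H)|` of two graphs with equally many vertices. -/
def spectralDistance {V W : Type} [Fintype V] [Fintype W] (G : SimpleGraph V) (H : SimpleGraph W)
    (h : Fintype.card V = Fintype.card W) : ℝ :=
  ∑ i : Fin (Fintype.card V), |adjEigenvalues G i - adjEigenvalues H (Fin.cast h i)|

/-- `σ(C_{n}, Z_{n})`. -/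
def sigmaCZ (n : ℕ) (hn : 4 ≤ n) : ℝ :=
  spectralDistance (SimpleGraph.cycleGraph n) (zGraph n hn)
    ((Fintype.card_fin n).trans (card_ZVertex n hn).symm)

/-- `σ(P_n, Z_n)`. -/
def sigmaPZ (n : ℕ) (hn : 4 ≤ n) : ℝ :=
  spectralDistance (SimpleGraph.pathGraph n) (zGraph n hn)
    ((Fintype.card_fin n).trans (card_ZVertex n hn).symm)

/-- `σ(W_n, Z_n)`. -/
def sigmaWZ (n : ℕ) (hn : 6 ≤ n) : ℝ :=
  spectralDistance (wGraph n hn) (zGraph n (by omega))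
    ((card_WVertex n hn).trans (card_ZVertex n (by omega)).symm)

/-- `σ(P_n, W_n)`. -/
def sigmaPW (n : ℕ) (hn : 6 ≤ n) : ℝ :=
  spectralDistance (SimpleGraph.pathGraph n) (wGraph n hn)
    ((Fintype.card_fin n).trans (card_WVertex n hn).symm)

end

/-! ### Spectra from eigenvectors -/

/-! All four spectra are explicit. The eigenvalues are $2\cos\frac{(k+1)\pi}{n+1}$ for $P_n$;
$2\cos\frac{(2k+1)\pi}{2(n-1)}$ and one extra $0$ for $Z_n$; $2\cos\frac{k\pi}{n-3}$ and two extra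
$0$s for $W_n$; $2\cos\frac{2\pi\lceil k/2\rceil}{n}$ for $C_n$. They come from trigonometric
eigenvectors and, for the extra zeros, vectors taking opposite values on two twin leaves.

For $P_n$, $Z_n$, $W_n$ and even cycles the sorted spectrum is symmetric about $0$, so $\sigma$ is
twice a sum over its first half (`spectralDistance_eq_of_odd`). There, up to one vanishing middle
term, the eigenvalues of $P_n$, $Z_n$, $W_n$ are $2\cos\frac{k\pi+\alpha}{n+\beta}$ with
$(\alpha,\beta)=(\pi,1),(\pi/2,-1),(0,-3)$. With $z=\pi k/n$, each cosine is $\cos z-\sin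
z\,(\alpha-\beta z)/n+O(n^{-2})$, so the sum of the absolute differences is a Riemann sum up to
$O(1/n)$ (`tendsto_sum_abs_cos_sub_cos`), with limit $\int_0^{1/2}2|\sin\pi
t\,((\alpha-\alpha')-(\beta-\beta')\pi t)|\,dt$.

The three pairs $(\alpha,\beta)$ are in arithmetic progression. Hence $P,Z$ and $W,Z$ give the same
integrand, and $P,W$ gives its double. For $C_{2n}$ the indices are split by parity, and the two
resulting integrals add up to $\int_0^{1/2}\pi\sin\pi t\,dt=1$. -/

open Polynomial in
theorem charpoly_eq_prod_of_linearIndependent {K V ι : Type*} [Field K] [Fintype V] [DecidableEq V]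
    [Fintype ι] (A : Matrix V V K) (v : ι → V → K) (μ : ι → K) (hv : LinearIndependent K v)
    (hcard : Fintype.card ι = Fintype.card V) (h : ∀ i, A.mulVec (v i) = μ i • v i) :
    A.charpoly = ∏ i, (X - C (μ i)) := by
  classical
  have hspan : ⊤ ≤ Submodule.span K (Set.range v) :=
    (hv.span_eq_top_of_card_eq_finrank' (by simpa using hcard)).ge
  let b := Module.Basis.mk hv hspan
  have hD : LinearMap.toMatrix b b (Matrix.toLin' A) = Matrix.diagonal μ := by
    ext i j
    rw [LinearMap.toMatrix_apply]
    simp only [b, Module.Basis.mk_apply, Matrix.toLin'_apply, h, map_smul]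
    rw [← Module.Basis.mk_apply hv hspan j, Module.Basis.repr_self]
    by_cases hij : i = j
    · subst hij; simp
    · simp [Matrix.diagonal_apply_ne _ hij, Ne.symm hij]
  rw [← Matrix.charpoly_toLin', ← LinearMap.charpoly_toMatrix _ b, hD, Matrix.charpoly_diagonal]

theorem linearIndependent_of_mulVec_eq_smul {V ι : Type*} [Fintype V] [DecidableEq V]
    (A : Matrix V V ℝ) (v : ι → V → ℝ) (μ : ι → ℝ) (hμ : Function.Injective μ)
    (h : ∀ i, A.mulVec (v i) = μ i • v i) (h0 : ∀ i, v i ≠ 0) : LinearIndependent ℝ v :=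
  Module.End.eigenvectors_linearIndependent' (Matrix.toLin' A) μ hμ v fun i =>
    ⟨Module.End.mem_eigenspace_iff.2 (by rw [Matrix.toLin'_apply, h]), h0 i⟩

/-- The eigenvalue $0$ of the twin-leaf vectors may also occur in the trigonometric family, so
distinctness of eigenvalues cannot separate the two. Functionals that vanish on one family and are
dual to the other do. -/
theorem LinearIndependent.sum_elim_of_dual {K M ι κ : Type*} [Field K] [AddCommGroup M]
    [Module K M] [Fintype κ] [DecidableEq κ] {v : ι → M} {w : κ → M} (hv : LinearIndependent K v)
    (φ : κ → M →ₗ[K] K) (hφv : ∀ k i, φ k (v i) = 0)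
    (hφw : ∀ k l, φ k (w l) = if k = l then 1 else 0) : LinearIndependent K (Sum.elim v w) := by
  refine hv.sum_type (Fintype.linearIndependent_iff.2 fun g hg k => ?_) ?_
  · simpa [hφw] using congrArg (φ k) hg
  · rw [Submodule.disjoint_def]
    intro x hx hx'
    have hzero : ∀ k, φ k x = 0 := fun k => by
      have hle : Submodule.span K (Set.range v) ≤ LinearMap.ker (φ k) := by
        rw [Submodule.span_le]
        rintro _ ⟨i, rfl⟩
        exact hφv k i
      exact hle hx
    obtain ⟨c, rfl⟩ := (Submodule.mem_span_range_iff_exists_fun K).1 hx'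
    refine Finset.sum_eq_zero fun k _ => ?_
    have := hzero k
    simp only [map_sum, map_smul, hφw, smul_eq_mul, mul_ite, mul_one, mul_zero,
      Finset.sum_ite_eq, Finset.mem_univ, if_true] at this
    rw [this, zero_smul]

open Polynomial in
/-- An antitone list of the roots of the characteristic polynomial is the list of the
eigenvalues. -/
theorem adjEigenvalues_eq_of_charpoly {V : Type} [Fintype V] [DecidableEq V] (G : SimpleGraph V)
    [DecidableRel G.Adj] {n : ℕ} (hn : Fintype.card V = n) (μ : ℕ → ℝ)
    (hμ : ∀ i j, i ≤ j → j < n → μ j ≤ μ i)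
    (h : (G.adjMatrix ℝ).charpoly = ∏ i ∈ Finset.range n, (X - C (μ i)))
    (i : Fin (Fintype.card V)) : adjEigenvalues G i = μ i := by
  subst hn
  have hA : (G.adjMatrix ℝ).IsHermitian := by
    rw [Matrix.IsHermitian, Matrix.conjTranspose_eq_transpose_of_trivial]
    exact G.transpose_adjMatrix
  have h1 := hA.roots_charpoly_eq_eigenvalues₀
  rw [h, ← Fin.prod_univ_eq_prod_range (fun i => X - C (μ i)), Polynomial.roots_prod _ _
    (by simp [Finset.prod_ne_zero_iff, X_sub_C_ne_zero])] at h1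
  simp only [roots_X_sub_C, Multiset.bind_singleton] at h1
  have h2 : (List.ofFn fun i : Fin (Fintype.card V) => μ i).Perm (List.ofFn hA.eigenvalues₀) := by
    rw [← Multiset.coe_eq_coe, ← Fin.univ_val_map, ← Fin.univ_val_map]
    exact h1
  have h3 := h2.eq_of_pairwise' (Antitone.sortedGE_ofFn fun i j hij => hμ i j hij j.2).pairwise
    hA.eigenvalues₀_antitone.sortedGE_ofFn.pairwise
  rw [congrFun (List.ofFn_injective h3) i, adjEigenvalues]
  congr!

/-- Insertion of `x` at position `p` into a sequence. -/
noncomputable def insertAt (p : ℕ) (x : ℝ) (f : ℕ → ℝ) (k : ℕ) : ℝ :=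
  if k < p then f k else if k = p then x else f (k - 1)

theorem prod_range_insertAt {M : Type*} [CommMonoid M] (g : ℝ → M) (p : ℕ) (x : ℝ) (f : ℕ → ℝ)
    {n : ℕ} (hp : p ≤ n) : ∏ k ∈ Finset.range (n + 1), g (insertAt p x f k) =
      (∏ k ∈ Finset.range n, g (f k)) * g x := by
  induction n, hp using Nat.le_induction with
  | base =>
    rw [Finset.prod_range_succ]
    congr 1
    · refine Finset.prod_congr rfl fun k hk => ?_
      rw [insertAt, if_pos (Finset.mem_range.1 hk)]
    · simp [insertAt]
  | succ n hn ih =>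
    rw [Finset.prod_range_succ, ih, Finset.prod_range_succ, mul_right_comm]
    congr 2
    simp [insertAt, show ¬ n + 1 < p by omega, show n + 1 ≠ p by omega]

theorem insertAt_antitone {p : ℕ} {x : ℝ} {f : ℕ → ℝ} {n : ℕ}
    (hf : ∀ i j, i ≤ j → j < n → f j ≤ f i) (h1 : ∀ i < p, i < n → x ≤ f i)
    (h2 : ∀ i, p ≤ i → i < n → f i ≤ x) (i j : ℕ) (hij : i ≤ j) (hj : j < n + 1)
    (hp : p ≤ n) : insertAt p x f j ≤ insertAt p x f i := by
  unfold insertAt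
  split_ifs
  all_goals first | omega | skip
  · exact hf _ _ hij (by omega)
  · exact h1 _ (by omega) (by omega)
  · exact le_rfl
  · exact hf _ _ (by omega) (by omega)
  · exact h2 _ (by omega) (by omega)
  · exact hf _ _ (by omega) (by omega)

theorem spectralDistance_eq_of_odd {V W : Type} [Fintype V] [Fintype W] (G : SimpleGraph V)
    (H : SimpleGraph W) (h : Fintype.card V = Fintype.card W) {n : ℕ} (hn : Fintype.card V = n)
    (μ ν : ℕ → ℝ) (hμ : ∀ i, adjEigenvalues G i = μ i) (hν : ∀ i, adjEigenvalues H i = ν i)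
    (hμs : ∀ k < n, μ (n - 1 - k) = -μ k) (hνs : ∀ k < n, ν (n - 1 - k) = -ν k) :
    spectralDistance G H h = 2 * ∑ k ∈ Finset.range (n / 2), |μ k - ν k| := by
  have h1 : spectralDistance G H h = ∑ k ∈ Finset.range n, |μ k - ν k| := by
    rw [← hn, ← Fin.sum_univ_eq_sum_range (fun k => |μ k - ν k|)]
    simp [spectralDistance, hμ, hν]
  have h2 : ∀ a b, b ≤ 1 → (∀ k < 2 * a + b, |μ (2 * a + b - 1 - k) - ν (2 * a + b - 1 - k)| =
      |μ k - ν k|) → (b = 1 → |μ a - ν a| = 0) → ∑ k ∈ Finset.range (2 * a + b), |μ k - ν k| =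
      2 * ∑ k ∈ Finset.range a, |μ k - ν k| := by
    intro a b hb hs hm
    rw [show 2 * a + b = (a + b) + a by ring, Finset.sum_range_add, two_mul]
    congr 1
    · interval_cases b
      · rfl
      · rw [Finset.sum_range_succ, hm rfl, add_zero]
    · rw [← Finset.sum_range_reflect]
      refine Finset.sum_congr rfl fun k hk => ?_
      have hk' := Finset.mem_range.1 hk
      rw [← hs k (by omega), show 2 * a + b - 1 - k = a + b + (a - 1 - k) by omega]
  have hs : ∀ k < n, |μ (n - 1 - k) - ν (n - 1 - k)| = |μ k - ν k| := fun k hk => by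
    rw [hμs k hk, hνs k hk, ← abs_neg]; congr 1; ring
  rw [h1]
  have h3 : n = 2 * (n / 2) + n % 2 := by omega
  -- For odd `n` the middle index is its own mirror image, so both sequences vanish there.
  have h4 := h2 (n / 2) (n % 2) (by omega) (by rw [← h3]; exact hs) fun hb => by
    have e : n - 1 - n / 2 = n / 2 := by omega
    have e1 := hμs (n / 2) (by omega)
    have e2 := hνs (n / 2) (by omega)
    rw [e] at e1 e2
    rw [show μ (n / 2) = 0 by linarith, show ν (n / 2) = 0 by linarith]; simp
  rwa [← h3] at h4

/-! ### Spectra of the path and of its coalescences with `P_3` -/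

/-- The vertices sit at positions $1,\dots,m$, with ghost positions $0$ and $m+1$. A solution of the
two-sided recurrence is an eigenvector once the subtracted ghost terms vanish or are supplied by
attached leaves. -/
theorem sum_pathGraph_adj {m : ℕ} (i : Fin m) (g : ℕ → ℝ)
    [DecidableRel (SimpleGraph.pathGraph m).Adj] :
    (∑ j : Fin m, if (SimpleGraph.pathGraph m).Adj i j then g (j + 1) else 0) =
      g i + g (i + 2) - (if (i : ℕ) = 0 then g 0 else 0) -
        (if (i : ℕ) + 1 = m then g (m + 1) else 0) := by
  have h1 : ∀ j : Fin m, (if (SimpleGraph.pathGraph m).Adj i j then g (j + 1) else 0) =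
      (if (i : ℕ) + 1 = j then g (j + 1) else 0) + if (j : ℕ) + 1 = i then g (j + 1) else 0 := by
    intro j
    simp only [SimpleGraph.pathGraph_adj]
    split_ifs <;> first | omega | simp
  simp only [h1]
  rw [Finset.sum_add_distrib,
    Fin.sum_univ_eq_sum_range (fun j => if (i : ℕ) + 1 = j then g (j + 1) else 0),
    Fin.sum_univ_eq_sum_range (fun j => if j + 1 = (i : ℕ) then g (j + 1) else 0)]
  have hi := i.2
  have e1 : (∑ j ∈ Finset.range m, if (i : ℕ) + 1 = j then g (j + 1) else 0) =
      g (i + 2) - if (i : ℕ) + 1 = m then g (m + 1) else 0 := by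
    rw [Finset.sum_ite_eq]
    simp only [Finset.mem_range]
    split_ifs with h h' h'
    · omega
    · ring
    · rw [show (i : ℕ) + 2 = m + 1 by omega]; ring
    · omega
  have e2 : (∑ j ∈ Finset.range m, if j + 1 = (i : ℕ) then g (j + 1) else 0) =
      g i - if (i : ℕ) = 0 then g 0 else 0 := by
    rcases Nat.eq_zero_or_pos (i : ℕ) with h | h
    · simp [h]
    · obtain ⟨a, ha⟩ : ∃ a, (i : ℕ) = a + 1 := ⟨i - 1, by omega⟩
      simp only [ha, add_left_inj, Finset.sum_ite_eq', Finset.mem_range]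
      rw [if_pos (by omega), if_neg (by omega), sub_zero]
  rw [e1, e2]; ring

theorem sum_compl_center (F : {w : Fin 3 // w ≠ 1} → ℝ) :
    ∑ w, F w = F ⟨0, by decide⟩ + F ⟨2, by decide⟩ := by
  have : (Finset.univ : Finset {w : Fin 3 // w ≠ 1}) = {⟨0, by decide⟩, ⟨2, by decide⟩} := by
    decide
  rw [this, Finset.sum_pair (by decide)]

theorem forall_compl_center {p : {w : Fin 3 // w ≠ 1} → Prop} :
    (∀ w, p w) ↔ p ⟨0, by decide⟩ ∧ p ⟨2, by decide⟩ :=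
  ⟨fun h => ⟨h _, h _⟩, fun h w => by
    obtain ⟨w, hw⟩ := w
    fin_cases w
    · exact h.1
    · exact absurd rfl hw
    · exact h.2⟩

/-- The function on the two leaves of `P_3` taking opposite values. -/
noncomputable def leafSign (w : {w : Fin 3 // w ≠ 1}) : ℝ := if w.1 = 0 then 1 / 2 else -(1 / 2)

theorem leafSign_zero : leafSign ⟨0, by decide⟩ = 1 / 2 := by simp [leafSign]

theorem leafSign_two : leafSign ⟨2, by decide⟩ = -(1 / 2) := by simp [leafSign]

theorem adjMatrix_mulVec_eq_sum_ite {V : Type} [Fintype V] (G : SimpleGraph V)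
    [DecidableRel G.Adj] (f : V → ℝ) (x : V) :
    (G.adjMatrix ℝ).mulVec f x = ∑ y, if G.Adj x y then f y else 0 := by
  simp [Matrix.mulVec, dotProduct, SimpleGraph.adjMatrix_apply]

theorem coalescence_mulVec_inl {V : Type} [Fintype V] [DecidableEq V] (G : SimpleGraph V)
    [DecidableRel G.Adj] (u : V) [DecidableRel (coalescence G u (SimpleGraph.pathGraph 3) 1).Adj]
    (f : V → ℝ)
    (g : {w : Fin 3 // w ≠ 1} → ℝ) (x : V) :
    ((coalescence G u (SimpleGraph.pathGraph 3) 1).adjMatrix ℝ).mulVec (Sum.elim f g) (Sum.inl x) =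
      (G.adjMatrix ℝ).mulVec f x +
        if x = u then g ⟨0, by decide⟩ + g ⟨2, by decide⟩ else 0 := by
  rw [adjMatrix_mulVec_eq_sum_ite, adjMatrix_mulVec_eq_sum_ite, Fintype.sum_sum_type,
    sum_compl_center]
  simp only [coalescence, Sum.elim_inl, Sum.elim_inr]
  by_cases h : x = u
  · simp [h, SimpleGraph.pathGraph_adj]
  · simp only [h, SimpleGraph.pathGraph_adj, false_and, if_false, add_zero]
    exact Finset.sum_congr rfl fun y _ => by by_cases hy : G.Adj x y <;> simp [hy]

theorem coalescence_mulVec_inr {V : Type} [Fintype V] [DecidableEq V] (G : SimpleGraph V)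
    [DecidableRel G.Adj] (u : V) [DecidableRel (coalescence G u (SimpleGraph.pathGraph 3) 1).Adj]
    (f : V → ℝ)
    (g : {w : Fin 3 // w ≠ 1} → ℝ) (w : {w : Fin 3 // w ≠ 1}) :
    ((coalescence G u (SimpleGraph.pathGraph 3) 1).adjMatrix ℝ).mulVec (Sum.elim f g) (Sum.inr w) =
      f u := by
  rw [adjMatrix_mulVec_eq_sum_ite, Fintype.sum_sum_type, sum_compl_center]
  revert w
  rw [forall_compl_center]
  simp [coalescence, SimpleGraph.pathGraph_adj]

theorem sin_mul_add_sin (a b θ : ℝ) : Real.sin ((a - b) * θ) + Real.sin ((a - (b + 2)) * θ) =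
    2 * Real.cos θ * Real.sin ((a - (b + 1)) * θ) := by
  rw [show (a - b) * θ = (a - (b + 1)) * θ + θ by ring,
    show (a - (b + 2)) * θ = (a - (b + 1)) * θ - θ by ring, Real.sin_add, Real.sin_sub]
  ring

theorem cos_mul_add_cos (b θ : ℝ) : Real.cos (b * θ) + Real.cos ((b + 2) * θ) =
    2 * Real.cos θ * Real.cos ((b + 1) * θ) := by
  rw [show b * θ = (b + 1) * θ - θ by ring, show (b + 2) * θ = (b + 1) * θ + θ by ring,
    Real.cos_add, Real.cos_sub]
  ring

theorem pathGraph_mulVec {m : ℕ} [DecidableRel (SimpleGraph.pathGraph m).Adj] (g : ℕ → ℝ)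
    (i : Fin m) :
    ((SimpleGraph.pathGraph m).adjMatrix ℝ).mulVec (fun j => g (j + 1)) i =
      g i + g (i + 2) - (if (i : ℕ) = 0 then g 0 else 0) -
        (if (i : ℕ) + 1 = m then g (m + 1) else 0) := by
  rw [adjMatrix_mulVec_eq_sum_ite, sum_pathGraph_adj]

theorem injective_two_mul_cos {n : ℕ} (θ : ℕ → ℝ) (h : ∀ i < n, θ i ∈ Set.Icc 0 Real.pi)
    (hθ : StrictMono θ) : Function.Injective fun i : Fin n => 2 * Real.cos (θ i) := by
  intro i j hij
  have := Real.injOn_cos (h i i.2) (h j j.2) (by simpa using hij)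
  exact Fin.ext (hθ.injective this)

-- The eigenvectors $\sin(l\theta)$ vanish at both ghost positions $0$ and $n+1$ when
-- $\theta\in\frac{\pi}{n+1}\mathbb Z$.
open Polynomial in
theorem charpoly_pathGraph (n : ℕ) [DecidableRel (SimpleGraph.pathGraph n).Adj] :
    ((SimpleGraph.pathGraph n).adjMatrix ℝ).charpoly =
    ∏ k ∈ Finset.range n, (X - C (2 * Real.cos ((k + 1) * Real.pi / (n + 1)))) := by
  rw [← Fin.prod_univ_eq_prod_range
    (fun k : ℕ => X - C (2 * Real.cos ((k + 1) * Real.pi / (n + 1))))]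
  let θ : ℕ → ℝ := fun k => (k + 1) * Real.pi / (n + 1)
  have hpos : ∀ k, 0 < θ k := fun k => by positivity
  have hlt : ∀ k < n, θ k < Real.pi := fun k hk => by
    have hk' : (k : ℝ) + 1 < n + 1 := by exact_mod_cast Nat.succ_lt_succ hk
    simp only [θ]
    rw [div_lt_iff₀ (by positivity), mul_comm]
    gcongr
  have hmono : StrictMono θ := fun a b hab => by
    simp only [θ]
    gcongr
  let v : Fin n → Fin n → ℝ := fun k j => Real.sin ((((j : ℕ) + 1 : ℕ) : ℝ) * θ k)
  have hv : ∀ k, ((SimpleGraph.pathGraph n).adjMatrix ℝ).mulVec (v k) =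
      (2 * Real.cos (θ k)) • v k := by
    intro k
    ext i
    have hp := pathGraph_mulVec (fun l : ℕ => Real.sin (l * θ k)) i
    beta_reduce at hp
    rw [hp]
    have h1 : Real.sin (((n + 1 : ℕ) : ℝ) * θ k) = 0 := by
      rw [show ((n + 1 : ℕ) : ℝ) * θ k = ((k : ℕ) + 1 : ℕ) * Real.pi by
        simp only [θ]; push_cast; field_simp]
      exact Real.sin_nat_mul_pi _
    have h2 := sin_mul_add_sin 0 (-(i : ℝ) - 2) (θ k)
    simp only [v, h1, Pi.smul_apply, smul_eq_mul, Nat.cast_zero, zero_mul, Real.sin_zero, ite_self,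
      sub_zero]
    push_cast
    ring_nf at h2 ⊢
    linarith
  refine charpoly_eq_prod_of_linearIndependent _ v _
    (linearIndependent_of_mulVec_eq_smul _ v (fun k => 2 * Real.cos (θ k))
      (injective_two_mul_cos θ (fun i hi => ⟨(hpos i).le, (hlt i hi).le⟩) hmono) hv
      fun k h0 => ?_) rfl hv
  have := congrFun h0 ⟨0, k.pos⟩
  simp only [v, zero_add, Nat.cast_one, one_mul, Pi.zero_apply] at this
  exact (Real.sin_pos_of_pos_of_lt_pi (hpos k) (hlt k k.2)).ne' this

/-- The angles of the eigenvalues of `Z_n`, where `m = n - 2`. -/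
noncomputable def zAngle (m k : ℕ) : ℝ := (2 * k + 1) * Real.pi / (2 * (m + 1))

theorem zAngle_pos (m k : ℕ) : 0 < zAngle m k := by unfold zAngle; positivity

theorem zAngle_lt_pi {m k : ℕ} (hk : k < m + 1) : zAngle m k < Real.pi := by
  have hk' : (k : ℝ) + 1 ≤ m + 1 := by exact_mod_cast hk
  unfold zAngle
  rw [div_lt_iff₀ (by positivity), mul_comm]
  gcongr
  linarith

theorem strictMono_zAngle (m : ℕ) : StrictMono (zAngle m) := fun a b hab => by
  unfold zAngle
  gcongr

theorem cos_succ_mul_zAngle (m k : ℕ) : Real.cos ((m + 1) * zAngle m k) = 0 := by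
  rw [Real.cos_eq_zero_iff]
  exact ⟨k, by unfold zAngle; push_cast; field_simp⟩

-- The sine is measured from the far end, so it vanishes at the ghost position $m+1$. Its value
-- $\sin((m+1)\theta)$ at the ghost position $0$ is shared equally by the two leaves, and the
-- equation at a leaf then follows from $\cos((m+1)\theta)=0$.
open Polynomial in
theorem charpoly_coalescence_pathGraph (m : ℕ) (hm : 0 < m) [DecidableRel
    (coalescence (SimpleGraph.pathGraph m) ⟨0, hm⟩ (SimpleGraph.pathGraph 3) 1).Adj] :
    ((coalescence (SimpleGraph.pathGraph m) ⟨0, hm⟩ (SimpleGraph.pathGraph 3) 1).adjMatrix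
      ℝ).charpoly = (∏ k ∈ Finset.range (m + 1), (X - C (2 * Real.cos (zAngle m k)))) *
        (X - C 0) := by
  classical
  set A := (coalescence (SimpleGraph.pathGraph m) ⟨0, hm⟩ (SimpleGraph.pathGraph 3) 1).adjMatrix ℝ
  let v : Fin (m + 1) → Fin m ⊕ {w : Fin 3 // w ≠ 1} → ℝ := fun k =>
    Sum.elim (fun j => Real.sin ((((m + 1 : ℕ) : ℝ) - ((j : ℕ) + 1 : ℕ)) * zAngle m k))
      fun _ => Real.sin ((m + 1) * zAngle m k) / 2
  let w : Unit → Fin m ⊕ {w : Fin 3 // w ≠ 1} → ℝ := fun _ => Sum.elim (fun _ => 0) leafSign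
  have hv : ∀ k, A.mulVec (v k) = (2 * Real.cos (zAngle m k)) • v k := by
    intro k
    ext x
    rcases x with i | l
    · have hp := pathGraph_mulVec
        (fun l : ℕ => Real.sin ((((m + 1 : ℕ) : ℝ) - l) * zAngle m k)) i
      beta_reduce at hp
      rw [coalescence_mulVec_inl, hp]
      have h2 := sin_mul_add_sin ((m + 1 : ℕ) : ℝ) i (zAngle m k)
      simp only [v, Pi.smul_apply, smul_eq_mul, Sum.elim_inl, sub_self, zero_mul, Real.sin_zero,
        ite_self, sub_zero, Fin.ext_iff]
      push_cast at h2 ⊢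
      rw [h2]
      split_ifs <;> simp
    · rw [coalescence_mulVec_inr]
      have := cos_succ_mul_zAngle m k
      simp only [v, Pi.smul_apply, smul_eq_mul, Sum.elim_inr]
      push_cast [zero_add]
      rw [show ((m : ℝ) + 1 - 1) * zAngle m k = (m + 1) * zAngle m k - zAngle m k by ring,
        Real.sin_sub, this]
      ring
  have hw : ∀ k, A.mulVec (w k) = (0 : ℝ) • w k := by
    intro k
    ext x
    rcases x with i | l
    · rw [coalescence_mulVec_inl, leafSign_zero, leafSign_two]
      simp
    · rw [coalescence_mulVec_inr]; simp
  let φ : (Fin m ⊕ {w : Fin 3 // w ≠ 1} → ℝ) →ₗ[ℝ] ℝ :=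
    LinearMap.proj (Sum.inr ⟨0, by decide⟩) - LinearMap.proj (Sum.inr ⟨2, by decide⟩)
  have hLI : LinearIndependent ℝ (Sum.elim v w) := by
    refine LinearIndependent.sum_elim_of_dual
      (linearIndependent_of_mulVec_eq_smul A v (fun k => 2 * Real.cos (zAngle m k))
        (injective_two_mul_cos _ (fun i hi => ⟨(zAngle_pos m i).le, (zAngle_lt_pi hi).le⟩)
          (strictMono_zAngle m)) hv fun k h0 => ?_) (fun _ => φ) ?_ ?_
    · have h1 := congrFun h0 (Sum.inr ⟨0, by decide⟩)
      have h2 := Real.sin_sq_add_cos_sq ((m + 1) * zAngle m k)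
      rw [cos_succ_mul_zAngle] at h2
      simp only [v, Sum.elim_inr, Pi.zero_apply] at h1
      rw [show Real.sin ((m + 1) * zAngle m k) = 0 by linarith] at h2
      norm_num at h2
    · intro _ i; simp [φ, v]
    · intro _ _; simp [φ, w, leafSign_zero, leafSign_two]; norm_num
  rw [charpoly_eq_prod_of_linearIndependent A (Sum.elim v w)
    (Sum.elim (fun k : Fin (m + 1) => 2 * Real.cos (zAngle m k)) fun _ => 0) hLI
    (by simp) (by rintro (k | k); exacts [hv k, hw k]),
    Fintype.prod_sum_type, ← Fin.prod_univ_eq_prod_range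
      (fun k : ℕ => X - C (2 * Real.cos (zAngle m k)))]
  simp

/-- The angles of the eigenvalues of `W_n` other than the two extra zeros, where `m = n - 4`. -/
noncomputable def wAngle (m k : ℕ) : ℝ := k * Real.pi / (m + 1)

theorem wAngle_nonneg (m k : ℕ) : 0 ≤ wAngle m k := by unfold wAngle; positivity

theorem wAngle_le_pi {m k : ℕ} (hk : k < m + 2) : wAngle m k ≤ Real.pi := by
  have hk' : (k : ℝ) ≤ m + 1 := by exact_mod_cast Nat.lt_succ_iff.1 hk
  unfold wAngle
  rw [div_le_iff₀ (by positivity), mul_comm]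
  gcongr

theorem strictMono_wAngle (m : ℕ) : StrictMono (wAngle m) := fun a b hab => by
  unfold wAngle
  gcongr

theorem sin_succ_mul_wAngle (m k : ℕ) : Real.sin ((m + 1) * wAngle m k) = 0 := by
  rw [show (m + 1) * wAngle m k = k * Real.pi by unfold wAngle; field_simp]
  exact Real.sin_nat_mul_pi _

-- The cosine $\cos(l\theta)$ has its ghost values at $0$ and $m+1$ each split between two leaves.
-- The leaf equation at position $1$ is automatic; the one at position $m$ follows from
-- $\sin((m+1)\theta)=0$.
open Polynomial in
theorem charpoly_coalescence_coalescence_pathGraph (m : ℕ) (hm : 0 < m) [DecidableRel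
    (coalescence (coalescence (SimpleGraph.pathGraph m) ⟨0, hm⟩ (SimpleGraph.pathGraph 3) 1)
      (Sum.inl ⟨m - 1, Nat.sub_lt hm one_pos⟩) (SimpleGraph.pathGraph 3) 1).Adj] :
    ((coalescence (coalescence (SimpleGraph.pathGraph m) ⟨0, hm⟩ (SimpleGraph.pathGraph 3) 1)
      (Sum.inl ⟨m - 1, Nat.sub_lt hm one_pos⟩) (SimpleGraph.pathGraph 3) 1).adjMatrix ℝ).charpoly =
      (∏ k ∈ Finset.range (m + 2), (X - C (2 * Real.cos (wAngle m k)))) *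
        (X - C 0) * (X - C 0) := by
  classical
  set A := (coalescence (coalescence (SimpleGraph.pathGraph m) ⟨0, hm⟩ (SimpleGraph.pathGraph 3) 1)
      (Sum.inl ⟨m - 1, Nat.sub_lt hm one_pos⟩) (SimpleGraph.pathGraph 3) 1).adjMatrix ℝ
  let v : Fin (m + 2) → (Fin m ⊕ {w : Fin 3 // w ≠ 1}) ⊕ {w : Fin 3 // w ≠ 1} → ℝ := fun k =>
    Sum.elim (Sum.elim (fun j => Real.cos (((j : ℕ) + 1 : ℕ) * wAngle m k)) fun _ => 1 / 2)
      fun _ => Real.cos ((m + 1) * wAngle m k) / 2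
  let w : Bool → (Fin m ⊕ {w : Fin 3 // w ≠ 1}) ⊕ {w : Fin 3 // w ≠ 1} → ℝ := fun b =>
    if b then Sum.elim (Sum.elim (fun _ => 0) leafSign) fun _ => 0 else
      Sum.elim (Sum.elim (fun _ => 0) fun _ => 0) leafSign
  have hv : ∀ k, A.mulVec (v k) = (2 * Real.cos (wAngle m k)) • v k := by
    intro k
    ext x
    rcases x with (i | l) | l
    · have hp := pathGraph_mulVec (fun l : ℕ => Real.cos (l * wAngle m k)) i
      beta_reduce at hp
      rw [coalescence_mulVec_inl, coalescence_mulVec_inl, hp]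
      have h2 := cos_mul_add_cos i (wAngle m k)
      simp only [v, Pi.smul_apply, smul_eq_mul, Sum.elim_inl, Sum.inl.injEq, Fin.ext_iff]
      have h3 : (i : ℕ) + 1 = m ↔ (i : ℕ) = m - 1 := by omega
      push_cast at h2 ⊢
      rw [h2, zero_mul, Real.cos_zero]
      simp only [h3]
      split_ifs <;> ring
    · rw [coalescence_mulVec_inl, coalescence_mulVec_inr]
      simp only [v, Pi.smul_apply, smul_eq_mul, Sum.elim_inl, Sum.elim_inr, reduceCtorEq, if_false]
      push_cast
      ring_nf
    · rw [coalescence_mulVec_inr]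
      have := sin_succ_mul_wAngle m k
      simp only [v, Pi.smul_apply, smul_eq_mul, Sum.elim_inr, Sum.elim_inl]
      rw [show ((m - 1 + 1 : ℕ) : ℝ) * wAngle m k = (m + 1) * wAngle m k - wAngle m k by
        rw [Nat.sub_add_cancel hm]; ring, Real.cos_sub, this]
      ring
  have hw : ∀ k, A.mulVec (w k) = (0 : ℝ) • w k := by
    intro k
    ext x
    simp only [w, zero_smul, Pi.zero_apply]
    split_ifs <;> rcases x with (i | l) | l <;>
      simp only [A, coalescence_mulVec_inl, coalescence_mulVec_inr, leafSign_zero, leafSign_two,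
        Sum.elim_inl] <;>
      simp
  let φ : Bool → ((Fin m ⊕ {w : Fin 3 // w ≠ 1}) ⊕ {w : Fin 3 // w ≠ 1} → ℝ) →ₗ[ℝ] ℝ := fun b =>
    if b then LinearMap.proj (Sum.inl (Sum.inr ⟨0, by decide⟩)) -
      LinearMap.proj (Sum.inl (Sum.inr ⟨2, by decide⟩))
    else LinearMap.proj (Sum.inr ⟨0, by decide⟩) - LinearMap.proj (Sum.inr ⟨2, by decide⟩)
  have hLI : LinearIndependent ℝ (Sum.elim v w) := by
    refine LinearIndependent.sum_elim_of_dual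
      (linearIndependent_of_mulVec_eq_smul A v (fun k => 2 * Real.cos (wAngle m k))
        (injective_two_mul_cos _ (fun i hi => ⟨wAngle_nonneg m i, wAngle_le_pi hi⟩)
          (strictMono_wAngle m)) hv fun k h0 => ?_) φ ?_ ?_
    · have h1 := congrFun h0 (Sum.inl (Sum.inr ⟨0, by decide⟩))
      norm_num [v] at h1
    · rintro (_ | _) i <;> simp [φ, v]
    · rintro (_ | _) (_ | _) <;> simp [φ, w, leafSign_zero, leafSign_two] <;> norm_num
  rw [charpoly_eq_prod_of_linearIndependent A (Sum.elim v w)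
    (Sum.elim (fun k : Fin (m + 2) => 2 * Real.cos (wAngle m k)) fun _ => 0) hLI
    (by simp) (by rintro (k | k); exacts [hv k, hw k]),
    Fintype.prod_sum_type, ← Fin.prod_univ_eq_prod_range
      (fun k : ℕ => X - C (2 * Real.cos (wAngle m k)))]
  simp [pow_two, mul_assoc]

/-! ### Spectrum of the cycle -/

-- The characters $x\mapsto z^x$ of the cyclic group are eigenvectors. Cycle eigenvalues repeat, so
-- independence comes from the Vandermonde determinant instead of from distinct eigenvalues.
open Polynomial in
theorem charpoly_cycleGraph_of_injective {n : ℕ} [DecidableRel (SimpleGraph.cycleGraph (n + 3)).Adj]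
    (z : Fin (n + 3) → ℂ) (hz : Function.Injective z) (hz1 : ∀ k, z k ^ (n + 3) = 1) :
    ((SimpleGraph.cycleGraph (n + 3)).adjMatrix ℂ).charpoly =
      ∏ k, (X - C (z k + (z k)⁻¹)) := by
  have hz0 : ∀ k, z k ≠ 0 := fun k h => by simpa [h] using hz1 k
  refine charpoly_eq_prod_of_linearIndependent _ (fun k => Matrix.vandermonde z k) _
    (Matrix.linearIndependent_rows_of_det_ne_zero (Matrix.det_vandermonde_ne_zero_iff.2 hz)) rfl
    fun k => ?_
  have hsucc : ∀ x : Fin (n + 3), z k ^ ((x + 1 : Fin (n + 3)) : ℕ) = z k * z k ^ (x : ℕ) := by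
    intro x
    rw [Fin.val_add, ← pow_eq_pow_mod _ (hz1 k), Fin.val_one, pow_succ']
  have hpred : ∀ x : Fin (n + 3), z k ^ ((x - 1 : Fin (n + 3)) : ℕ) = (z k)⁻¹ * z k ^ (x : ℕ) := by
    intro x
    have := hsucc (x - 1)
    rw [sub_add_cancel] at this
    rw [this, inv_mul_cancel_left₀ (hz0 k)]
  ext x
  have hne : x - 1 ≠ x + 1 := by
    intro h
    have h2 : (1 + 1 : Fin (n + 3)) = 0 := by
      rw [show (1 + 1 : Fin (n + 3)) = (x + 1) - (x - 1) by abel, h, sub_self]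
    have h3 := congrArg Fin.val h2
    rw [Fin.val_add, Fin.val_one, Nat.mod_eq_of_lt (by omega)] at h3
    simp at h3
  have hN : (SimpleGraph.cycleGraph (n + 3)).neighborFinset x = {x - 1, x + 1} := by
    ext y
    have := SimpleGraph.cycleGraph_neighborSet (n := n + 1) (v := x)
    rw [SimpleGraph.mem_neighborFinset, ← SimpleGraph.mem_neighborSet, this]
    simp
  rw [SimpleGraph.adjMatrix_mulVec_apply, hN, Finset.sum_pair hne]
  simp only [Matrix.vandermonde_apply, hsucc, hpred, Pi.smul_apply, smul_eq_mul]
  ring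

open Polynomial in
theorem charpoly_cycleGraph {N : ℕ} (hN : 3 ≤ N) [DecidableRel (SimpleGraph.cycleGraph N).Adj] :
    ((SimpleGraph.cycleGraph N).adjMatrix ℝ).charpoly =
      ∏ k ∈ Finset.range N, (X - C (2 * Real.cos (2 * Real.pi * ((k + 1) / 2 : ℕ) / N))) := by
  obtain ⟨n, rfl⟩ : ∃ n, N = n + 3 := ⟨N - 3, by omega⟩
  have hζ := Complex.isPrimitiveRoot_exp (n + 3) (by omega)
  set ζ := Complex.exp (2 * Real.pi * Complex.I / (n + 3 : ℕ)) with hζdef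
  -- The exponents run through $0,1,-1,2,-2,\dots$, which lists the eigenvalues in decreasing order.
  -- Any two differ by less than $n+3$, so the roots of unity are distinct.
  let e : ℕ → ℤ := fun k => if k % 2 = 1 then ((k + 1) / 2 : ℕ) else -((k + 1) / 2 : ℕ)
  have hζ0 : ζ ≠ 0 := Complex.exp_ne_zero _
  let z : Fin (n + 3) → ℂ := fun k => ζ ^ e k
  have hinj : Function.Injective z := by
    intro k l hkl
    have h1 : ζ ^ (e k - e l) = 1 := by
      rw [zpow_sub₀ hζ0, div_eq_one_iff_eq (zpow_ne_zero _ hζ0)]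
      exact hkl
    rw [hζ.zpow_eq_one_iff_dvd] at h1
    have hk := k.2
    have hl := l.2
    have h2 : e k - e l = 0 := by
      refine Int.eq_zero_of_abs_lt_dvd h1 ?_
      simp only [e]
      rw [abs_lt]
      split_ifs <;> constructor <;> omega
    refine Fin.ext ?_
    simp only [e] at h2
    split_ifs at h2 <;> omega
  have hpow : ∀ k, z k ^ (n + 3) = 1 := by
    intro k
    simp only [z]
    rw [← zpow_natCast, ← zpow_mul, hζ.zpow_eq_one_iff_dvd]
    exact dvd_mul_left _ _
  have hval : ∀ k : Fin (n + 3), z k + (z k)⁻¹ =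
      ((2 * Real.cos (2 * Real.pi * (((k : ℕ) + 1) / 2 : ℕ) / (n + 3 : ℕ)) : ℝ) : ℂ) := by
    intro k
    have h1 : ∀ a : ℕ, ζ ^ (a : ℤ) + (ζ ^ (a : ℤ))⁻¹ =
        ((2 * Real.cos (2 * Real.pi * a / (n + 3 : ℕ)) : ℝ) : ℂ) := by
      intro a
      rw [hζdef, ← Complex.exp_int_mul, ← Complex.exp_neg]
      push_cast
      rw [Complex.two_cos]
      congr 2 <;> ring
    simp only [z, e]
    split_ifs
    · exact h1 _
    · rw [zpow_neg, inv_inv, add_comm]; exact h1 _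
  refine Polynomial.map_injective (algebraMap ℝ ℂ) (algebraMap ℝ ℂ).injective ?_
  have h2 := charpoly_cycleGraph_of_injective z hinj hpow
  rw [← Matrix.charpoly_map, Polynomial.map_prod, ← Fin.prod_univ_eq_prod_range
    (fun k : ℕ => Polynomial.map (algebraMap ℝ ℂ)
      (X - C (2 * Real.cos (2 * Real.pi * ((k + 1) / 2 : ℕ) / (n + 3 : ℕ)))))]
  convert h2 using 2
  · ext i j
    simp [SimpleGraph.adjMatrix_apply, apply_ite]
  · ext k
    rw [hval, Polynomial.map_sub, Polynomial.map_X, Polynomial.map_C]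
    rfl

/-! ### Sorted spectra -/

/-- The first `n` terms of `f` are decreasing and symmetric about zero. -/
structure IsOddAntitone (n : ℕ) (f : ℕ → ℝ) : Prop where
  antitone : ∀ i j, i ≤ j → j < n → f j ≤ f i
  odd : ∀ k < n, f (n - 1 - k) = -f k

theorem isOddAntitone_two_mul_cos {n : ℕ} {θ : ℕ → ℝ} (hθ : Monotone θ)
    (hmem : ∀ k < n, θ k ∈ Set.Icc 0 Real.pi) (hodd : ∀ k < n, θ (n - 1 - k) = Real.pi - θ k) :
    IsOddAntitone n fun k => 2 * Real.cos (θ k) where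
  antitone i j hij hj := by
    have := Real.antitoneOn_cos (hmem i (by omega)) (hmem j hj) (hθ hij)
    linarith
  odd k hk := by
    simp only [hodd k hk, Real.cos_pi_sub]
    ring

/-- For even `n` the position is the exact middle. For odd `n` the sequence already has a zero in
the middle, and the new zero is placed just after it. -/
theorem IsOddAntitone.insertAt_zero {n : ℕ} {f : ℕ → ℝ} (hf : IsOddAntitone n f) :
    IsOddAntitone (n + 1) (insertAt ((n + 1) / 2) 0 f) where
  antitone i j hij hj := by
    refine insertAt_antitone hf.antitone (fun i hi hin => ?_) (fun i hi hin => ?_) i j hij hj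
      (by omega)
    · have h1 := hf.odd i hin
      have h2 := hf.antitone i (n - 1 - i) (by omega) (by omega)
      linarith
    · have h1 := hf.odd i hin
      have h2 := hf.antitone (n - 1 - i) i (by omega) (by omega)
      linarith
  odd k hk := by
    unfold insertAt
    split_ifs with h1 h2 h3 h4 h5 h6 h7 h8
    all_goals first | omega | skip
    · have := hf.odd (k - 1) (by omega)
      rw [show n - 1 - (k - 1) = k - 1 by omega] at this
      rw [show n + 1 - 1 - k = k - 1 by omega]
      linarith
    · have := hf.odd (k - 1) (by omega)
      rw [← this]; congr 1; omega
    · have := hf.odd k (by omega)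
      rw [show n - 1 - k = k by omega] at this
      linarith
    · simp
    · have := hf.odd k (by omega)
      rw [← this]; congr 1; omega

theorem isOddAntitone_pathGraph (n : ℕ) :
    IsOddAntitone n fun k => 2 * Real.cos ((k + 1) * Real.pi / (n + 1)) := by
  refine isOddAntitone_two_mul_cos (θ := fun k : ℕ => (k + 1) * Real.pi / (n + 1))
    (fun a b hab => ?_) (fun k hk => ⟨by positivity, ?_⟩) fun k hk => ?_
  · have : (a : ℝ) ≤ b := by exact_mod_cast hab
    simp only
    gcongr
  · have hk' : (k : ℝ) + 1 ≤ n := by exact_mod_cast hk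
    rw [div_le_iff₀ (by positivity), mul_comm]
    gcongr
  · rw [Nat.sub_sub, Nat.cast_sub (by omega)]
    push_cast
    field_simp
    ring

theorem isOddAntitone_zAngle (m : ℕ) :
    IsOddAntitone (m + 1) fun k => 2 * Real.cos (zAngle m k) :=
  isOddAntitone_two_mul_cos (strictMono_zAngle m).monotone
    (fun k hk => ⟨(zAngle_pos m k).le, (zAngle_lt_pi hk).le⟩) fun k hk => by
      unfold zAngle
      rw [Nat.add_sub_cancel, Nat.cast_sub (by omega)]
      field_simp
      ring

theorem isOddAntitone_wAngle (m : ℕ) :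
    IsOddAntitone (m + 2) fun k => 2 * Real.cos (wAngle m k) :=
  isOddAntitone_two_mul_cos (strictMono_wAngle m).monotone
    (fun k hk => ⟨wAngle_nonneg m k, wAngle_le_pi hk⟩) fun k hk => by
      unfold wAngle
      rw [show m + 2 - 1 - k = m + 1 - k by omega, Nat.cast_sub (by omega)]
      push_cast
      field_simp

theorem isOddAntitone_cycleGraph {M : ℕ} (hM : 0 < M) : IsOddAntitone (2 * M)
    fun k => 2 * Real.cos (2 * Real.pi * ((k + 1) / 2 : ℕ) / (2 * M : ℕ)) := by
  refine isOddAntitone_two_mul_cos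
    (θ := fun k : ℕ => 2 * Real.pi * ((k + 1) / 2 : ℕ) / (2 * M : ℕ))
    (fun a b hab => ?_) (fun k hk => ⟨by positivity, ?_⟩) fun k hk => ?_
  · have : (((a + 1) / 2 : ℕ) : ℝ) ≤ ((b + 1) / 2 : ℕ) := by
      exact_mod_cast Nat.div_le_div_right (by omega)
    simp only
    gcongr
  · have hk' : (((k + 1) / 2 : ℕ) : ℝ) ≤ M := by
      exact_mod_cast (by omega : (k + 1) / 2 ≤ M)
    push_cast
    rw [div_le_iff₀ (by positivity)]
    nlinarith [Real.pi_pos]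
  · rw [show (2 * M - 1 - k + 1) / 2 = M - (k + 1) / 2 by omega, Nat.cast_sub (by omega)]
    push_cast
    field_simp

theorem adjEigenvalues_pathGraph (n : ℕ) (i) : adjEigenvalues (SimpleGraph.pathGraph n) i =
    2 * Real.cos (((i : ℕ) + 1) * Real.pi / (n + 1)) := by
  classical
  exact adjEigenvalues_eq_of_charpoly _ (Fintype.card_fin n)
    (fun k => 2 * Real.cos ((k + 1) * Real.pi / (n + 1))) (isOddAntitone_pathGraph n).antitone
    (charpoly_pathGraph n) i

theorem adjEigenvalues_cycleGraph {M : ℕ} (hM : 2 ≤ M) (i) :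
    adjEigenvalues (SimpleGraph.cycleGraph (2 * M)) i =
      2 * Real.cos (2 * Real.pi * (((i : ℕ) + 1) / 2 : ℕ) / (2 * M : ℕ)) := by
  classical
  exact adjEigenvalues_eq_of_charpoly _ (Fintype.card_fin (2 * M))
    (fun k => 2 * Real.cos (2 * Real.pi * ((k + 1) / 2 : ℕ) / (2 * M : ℕ)))
    (isOddAntitone_cycleGraph (by omega)).antitone (charpoly_cycleGraph (by omega)) i

/-- The eigenvalues of `Z_n` in decreasing order, where `m = n - 2`. -/
noncomputable def zSpectrum (m : ℕ) : ℕ → ℝ :=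
  insertAt ((m + 1 + 1) / 2) 0 fun k => 2 * Real.cos (zAngle m k)

theorem isOddAntitone_zSpectrum (m : ℕ) : IsOddAntitone (m + 2) (zSpectrum m) :=
  (isOddAntitone_zAngle m).insertAt_zero

/-- The eigenvalues of `W_n` in decreasing order, where `m = n - 4`. -/
noncomputable def wSpectrum (m : ℕ) : ℕ → ℝ :=
  insertAt ((m + 3 + 1) / 2) 0
    (insertAt ((m + 2 + 1) / 2) 0 fun k => 2 * Real.cos (wAngle m k))

theorem isOddAntitone_wSpectrum (m : ℕ) : IsOddAntitone (m + 4) (wSpectrum m) :=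
  (isOddAntitone_wAngle m).insertAt_zero.insertAt_zero

open Polynomial in
theorem adjEigenvalues_zGraph (m : ℕ) (hm : 4 ≤ m + 2) (i) :
    adjEigenvalues (zGraph (m + 2) hm) i = zSpectrum m i := by
  classical
  refine adjEigenvalues_eq_of_charpoly _ (card_ZVertex (m + 2) hm) (zSpectrum m)
    (isOddAntitone_zSpectrum m).antitone ?_ i
  rw [zSpectrum, prod_range_insertAt (fun x => X - C x) _ _ _ (by omega)]
  exact charpoly_coalescence_pathGraph m (by omega)

open Polynomial in
theorem adjEigenvalues_wGraph (m : ℕ) (hm : 6 ≤ m + 4) (i) :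
    adjEigenvalues (wGraph (m + 4) hm) i = wSpectrum m i := by
  classical
  refine adjEigenvalues_eq_of_charpoly _ (card_WVertex (m + 4) hm) (wSpectrum m)
    (isOddAntitone_wSpectrum m).antitone ?_ i
  rw [wSpectrum, prod_range_insertAt (fun x => X - C x) _ _ _ (by omega),
    prod_range_insertAt (fun x => X - C x) _ _ _ (by omega)]
  exact charpoly_coalescence_coalescence_pathGraph m (by omega)

/-! ### Spectral distances as sums over half the spectrum -/

theorem two_mul_cos_zAngle (m k : ℕ) : 2 * Real.cos (zAngle m k) =
    2 * Real.cos ((k * Real.pi + Real.pi / 2) / (((m + 2 : ℕ) : ℝ) + -1)) := by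
  unfold zAngle
  congr 2
  push_cast
  rw [show (m : ℝ) + 2 + -1 = m + 1 by ring]
  field_simp

theorem zSpectrum_of_lt {m k : ℕ} (hk : k < (m + 2) / 2) : zSpectrum m k =
    2 * Real.cos ((k * Real.pi + Real.pi / 2) / (((m + 2 : ℕ) : ℝ) + -1)) := by
  rw [zSpectrum, insertAt, if_pos (by omega), two_mul_cos_zAngle]

theorem wSpectrum_of_lt {m k : ℕ} (hk : k < (m + 3) / 2) : wSpectrum m k =
    2 * Real.cos ((k * Real.pi + 0) / (((m + 4 : ℕ) : ℝ) + -3)) := by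
  rw [wSpectrum, insertAt, if_pos (by omega), insertAt, if_pos (by omega), wAngle]
  congr 2
  push_cast
  ring

/-- With $n=m+4$, such an index exists only for even $n$, namely $k=n/2-1$: one of the two extra
zeros of $W_n$ then falls in the first half. -/
theorem wSpectrum_eq_zero {m k : ℕ} (hk : (m + 3) / 2 ≤ k) (hk' : k < (m + 4) / 2) :
    wSpectrum m k = 0 := by
  rw [wSpectrum, insertAt, if_pos (by omega), insertAt, if_neg (by omega), if_pos (by omega)]

theorem sigmaCZ_eq (M : ℕ) (hM : 4 ≤ 2 * M) : sigmaCZ (2 * M) hM =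
    2 * ∑ k ∈ Finset.range M, |2 * Real.cos (2 * Real.pi * ((k + 1) / 2 : ℕ) / (2 * M : ℕ)) -
      2 * Real.cos ((k * Real.pi + Real.pi / 2) / (((2 * M : ℕ) : ℝ) + -1))| := by
  have key : ∀ m (hm : 4 ≤ m + 2), m + 2 = 2 * M → sigmaCZ (m + 2) hm =
      2 * ∑ k ∈ Finset.range ((m + 2) / 2),
        |2 * Real.cos (2 * Real.pi * ((k + 1) / 2 : ℕ) / (2 * M : ℕ)) - zSpectrum m k| := by
    intro m hm h
    refine spectralDistance_eq_of_odd _ _ _ (Fintype.card_fin (m + 2))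
      (fun k => 2 * Real.cos (2 * Real.pi * ((k + 1) / 2 : ℕ) / (2 * M : ℕ))) _ ?_
      (adjEigenvalues_zGraph m hm) ?_ (isOddAntitone_zSpectrum m).odd
    · rw [h]; exact adjEigenvalues_cycleGraph (by omega)
    · rw [h]; exact (isOddAntitone_cycleGraph (by omega)).odd
  obtain ⟨m, hm⟩ : ∃ m, m + 2 = 2 * M := ⟨2 * M - 2, by omega⟩
  have := key m (by omega) hm
  simp only [hm] at this
  rw [this, Nat.mul_div_cancel_left _ two_pos]
  congr 1
  refine Finset.sum_congr rfl fun k hk => ?_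
  rw [zSpectrum_of_lt (by rw [hm]; simpa using hk), hm]

theorem sigmaPZ_eq (n : ℕ) (hn : 4 ≤ n) : sigmaPZ n hn =
    2 * ∑ k ∈ Finset.range (n / 2), |2 * Real.cos ((k * Real.pi + Real.pi) / ((n : ℝ) + 1)) -
      2 * Real.cos ((k * Real.pi + Real.pi / 2) / ((n : ℝ) + -1))| := by
  obtain ⟨m, rfl⟩ : ∃ m, n = m + 2 := ⟨n - 2, by omega⟩
  rw [sigmaPZ, spectralDistance_eq_of_odd _ _ _ (Fintype.card_fin (m + 2))
    (fun k => 2 * Real.cos ((k + 1) * Real.pi / ((m + 2 : ℕ) + 1))) _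
    (adjEigenvalues_pathGraph _) (adjEigenvalues_zGraph m hn) (isOddAntitone_pathGraph _).odd
    (isOddAntitone_zSpectrum m).odd]
  congr 1
  refine Finset.sum_congr rfl fun k hk => ?_
  rw [zSpectrum_of_lt (Finset.mem_range.1 hk), add_mul, one_mul]

theorem sum_range_add_ite_parity (n : ℕ) (hn : 1 ≤ n) (F : ℕ → ℝ) :
    ∑ k ∈ Finset.range (n / 2), F k = (∑ k ∈ Finset.range ((n - 1) / 2), F k) +
      if n % 2 = 0 then F (n / 2 - 1) else 0 := by
  split_ifs with h
  · rw [show n / 2 = (n - 1) / 2 + 1 by omega, Finset.sum_range_succ, Nat.add_sub_cancel]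
  · rw [show n / 2 = (n - 1) / 2 by omega, add_zero]

theorem sigmaWZ_eq (n : ℕ) (hn : 6 ≤ n) : sigmaWZ n hn =
    2 * ((∑ k ∈ Finset.range ((n - 1) / 2), |2 * Real.cos ((k * Real.pi + 0) / ((n : ℝ) + -3)) -
      2 * Real.cos ((k * Real.pi + Real.pi / 2) / ((n : ℝ) + -1))|) + if n % 2 = 0 then
      |2 * Real.cos (((n / 2 - 1 : ℕ) * Real.pi + Real.pi / 2) / ((n : ℝ) + -1))| else 0) := by
  obtain ⟨m, rfl⟩ : ∃ m, n = m + 4 := ⟨n - 4, by omega⟩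
  rw [sigmaWZ, spectralDistance_eq_of_odd _ _ _ (card_WVertex _ hn) _ _
    (adjEigenvalues_wGraph m hn) (adjEigenvalues_zGraph (m + 2) (by omega))
    (isOddAntitone_wSpectrum m).odd (isOddAntitone_zSpectrum (m + 2)).odd,
    sum_range_add_ite_parity _ (by omega)]
  congr 2
  · refine Finset.sum_congr rfl fun k hk => ?_
    have hk' := Finset.mem_range.1 hk
    rw [zSpectrum_of_lt (by omega), wSpectrum_of_lt (by omega)]
  · split_ifs
    · rw [zSpectrum_of_lt (by omega), wSpectrum_eq_zero (by omega) (by omega), zero_sub, abs_neg]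
    · rfl

theorem sigmaPW_eq (n : ℕ) (hn : 6 ≤ n) : sigmaPW n hn =
    2 * ((∑ k ∈ Finset.range ((n - 1) / 2),
      |2 * Real.cos ((k * Real.pi + Real.pi) / ((n : ℝ) + 1)) -
      2 * Real.cos ((k * Real.pi + 0) / ((n : ℝ) + -3))|) + if n % 2 = 0 then
      |2 * Real.cos (((n / 2 - 1 : ℕ) * Real.pi + Real.pi) / ((n : ℝ) + 1))| else 0) := by
  obtain ⟨m, rfl⟩ : ∃ m, n = m + 4 := ⟨n - 4, by omega⟩
  rw [sigmaPW, spectralDistance_eq_of_odd _ _ _ (Fintype.card_fin (m + 4))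
    (fun k => 2 * Real.cos ((k + 1) * Real.pi / ((m + 4 : ℕ) + 1))) _
    (adjEigenvalues_pathGraph _) (adjEigenvalues_wGraph m hn)
    (isOddAntitone_pathGraph _).odd (isOddAntitone_wSpectrum m).odd,
    sum_range_add_ite_parity _ (by omega)]
  congr 2
  · refine Finset.sum_congr rfl fun k hk => ?_
    have hk' := Finset.mem_range.1 hk
    rw [wSpectrum_of_lt (by omega), add_mul, one_mul]
  · split_ifs
    · rw [wSpectrum_eq_zero (by omega) (by omega), sub_zero, add_mul, one_mul]
    · rfl

/-! ### Riemann sums -/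

theorem abs_sum_sub_integral_le {g : ℝ → ℝ} (hg : Continuous g) {n m : ℕ} (hn : 0 < n)
    (hm : m ≤ n) {ε : ℝ} (h : ∀ k < m, ∀ t ∈ Set.Icc ((k : ℝ) / n) ((k + 1 : ℕ) / n),
      |g t - g (k / n)| ≤ ε) (hε : 0 ≤ ε) :
    |(∑ k ∈ Finset.range m, g (k / n) / n) - ∫ t in (0 : ℝ)..(m / n), g t| ≤ ε := by
  have hn' : (0 : ℝ) < n := by exact_mod_cast hn
  have h1 := intervalIntegral.sum_integral_adjacent_intervals (f := g) (μ := MeasureTheory.volume)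
    (a := fun k : ℕ => (k : ℝ) / n) (n := m) fun k _ => hg.intervalIntegrable _ _
  simp only [Nat.cast_zero, zero_div] at h1
  rw [← h1, ← Finset.sum_sub_distrib]
  refine (Finset.abs_sum_le_sum_abs _ _).trans ?_
  have hterm : ∀ k ∈ Finset.range m,
      |g (k / n) / n - ∫ t in ((k : ℝ) / n)..((k + 1 : ℕ) / n), g t| ≤ ε / n := by
    intro k hk
    have hlen : ((k + 1 : ℕ) : ℝ) / n - k / n = 1 / n := by push_cast; ring
    have hle : (k : ℝ) / n ≤ (k + 1 : ℕ) / n := by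
      rw [← sub_nonneg, hlen]; positivity
    have hint : (∫ t in ((k : ℝ) / n)..((k + 1 : ℕ) / n), (g t - g (k / n))) =
        (∫ t in ((k : ℝ) / n)..((k + 1 : ℕ) / n), g t) - g (k / n) / n := by
      rw [intervalIntegral.integral_sub (hg.intervalIntegrable _ _) (by simp),
        intervalIntegral.integral_const, hlen, smul_eq_mul]
      ring
    rw [abs_sub_comm, ← hint, ← Real.norm_eq_abs]
    refine (intervalIntegral.norm_integral_le_of_norm_le_const (C := ε) fun t ht => ?_).trans ?_
    · rw [Set.uIoc_of_le hle] at ht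
      exact h k (Finset.mem_range.1 hk) t ⟨ht.1.le, ht.2⟩
    · rw [hlen, abs_of_nonneg (by positivity)]
      exact le_of_eq (by ring)
  refine (Finset.sum_le_sum hterm).trans ?_
  rw [Finset.sum_const, Finset.card_range, nsmul_eq_mul, mul_div_assoc', div_le_iff₀ hn', mul_comm]
  gcongr

/-- Uniform continuity on $[0,1]$ makes the oscillation on each cell of length $1/n$ small; the
upper limit of integration converges by continuity of the primitive. -/
theorem tendsto_riemann_sum {g : ℝ → ℝ} (hg : Continuous g) {m : ℕ → ℕ} (hm : ∀ n, m n ≤ n) {c : ℝ}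
    (hc : Tendsto (fun n => (m n : ℝ) / n) atTop (𝓝 c)) :
    Tendsto (fun n => ∑ k ∈ Finset.range (m n), g (k / n) / n) atTop
      (𝓝 (∫ t in (0 : ℝ)..c, g t)) := by
  have h1 : Tendsto (fun n => ∫ t in (0 : ℝ)..(m n / n), g t) atTop
      (𝓝 (∫ t in (0 : ℝ)..c, g t)) :=
    ((intervalIntegral.continuous_primitive (fun a b => hg.intervalIntegrable a b) 0).tendsto
      c).comp hc
  have h2 : Tendsto (fun n => (∑ k ∈ Finset.range (m n), g (k / n) / n) -
      ∫ t in (0 : ℝ)..(m n / n), g t) atTop (𝓝 0) := by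
    rw [Metric.tendsto_atTop]
    intro ε hε
    obtain ⟨δ, hδ, H⟩ := Metric.uniformContinuousOn_iff.1
      ((isCompact_Icc (a := (0 : ℝ)) (b := 1)).uniformContinuousOn_of_continuous hg.continuousOn)
      (ε / 2) (by positivity)
    obtain ⟨N, hN⟩ := exists_nat_gt (1 / δ)
    refine ⟨N + 1, fun n hn => ?_⟩
    have hn0 : 0 < n := by omega
    have hn' : (0 : ℝ) < n := by exact_mod_cast hn0
    have hnδ : 1 / (n : ℝ) < δ := by
      have h3 : (N : ℝ) ≤ n := by exact_mod_cast (by omega : N ≤ n)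
      rw [div_lt_iff₀ hn', mul_comm, ← div_lt_iff₀ hδ]
      linarith
    rw [Real.dist_eq, sub_zero]
    refine lt_of_le_of_lt (abs_sum_sub_integral_le hg hn0 (hm n) (ε := ε / 2) ?_ (by positivity))
      (by linarith)
    intro k hk t ht
    have hk1 : ((k + 1 : ℕ) : ℝ) / n ≤ 1 := by
      rw [div_le_one hn']
      exact_mod_cast (hk.trans_le (hm n) : k + 1 ≤ n)
    have hk0 : (0 : ℝ) ≤ k / n := by positivity
    have hlen : ((k + 1 : ℕ) : ℝ) / n = k / n + 1 / n := by push_cast; ring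
    have h4 := H t ⟨hk0.trans ht.1, ht.2.trans hk1⟩ (k / n) ⟨hk0, (ht.1.trans ht.2).trans hk1⟩ (by
      rw [Real.dist_eq, abs_of_nonneg (by linarith [ht.1])]
      linarith [ht.2])
    rw [Real.dist_eq] at h4
    exact h4.le
  simpa using h2.add h1

theorem abs_cos_add_sub_le {z u : ℝ} (hu : |u| ≤ 1) :
    |Real.cos (z + u) - Real.cos z + u * Real.sin z| ≤ u ^ 2 := by
  have h1 : Real.cos (z + u) - Real.cos z + u * Real.sin z =
      Real.cos z * (Real.cos u - 1) + Real.sin z * (u - Real.sin u) := by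
    rw [Real.cos_add]; ring
  have hu0 := abs_nonneg u
  have h2 : |Real.cos u - 1| ≤ u ^ 2 / 2 := by
    rw [abs_le]
    constructor <;> linarith [Real.one_sub_sq_div_two_le_cos (x := u), Real.cos_le_one u,
      sq_nonneg u]
  have h3 : |u - Real.sin u| ≤ u ^ 2 / 2 := by
    have h4 := Real.sin_bound hu
    have h5 : |u - Real.sin u| ≤ |u| ^ 3 / 6 + |u| ^ 5 / 100 := by
      have h6 : u - Real.sin u = u ^ 3 / 6 - (Real.sin u - (u - u ^ 3 / 6)) := by ring
      have h7 : |u ^ 3 / 6| = |u| ^ 3 / 6 := by rw [abs_div, abs_pow]; norm_num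
      rw [h6, ← h7]
      exact (abs_sub _ _).trans (add_le_add le_rfl h4)
    have h8 : |u| ^ 3 ≤ |u| ^ 2 := pow_le_pow_of_le_one hu0 hu (by norm_num)
    have h9 : |u| ^ 5 ≤ |u| ^ 2 := pow_le_pow_of_le_one hu0 hu (by norm_num)
    rw [← sq_abs u]
    nlinarith [sq_nonneg |u|]
  rw [h1]
  refine (abs_add_le _ _).trans ?_
  rw [abs_mul, abs_mul]
  have h4 := mul_le_mul (Real.abs_cos_le_one z) h2 (abs_nonneg _) zero_le_one
  have h5 := mul_le_mul (Real.abs_sin_le_one z) h3 (abs_nonneg _) zero_le_one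
  linarith

theorem exists_abs_cos_div_sub_le (α β : ℝ) : ∃ C N : ℝ, 0 < N ∧ ∀ n z : ℝ, N ≤ n → 0 ≤ z →
    z ≤ Real.pi → |Real.cos ((n * z + α) / (n + β)) - Real.cos z +
      Real.sin z * (α - β * z) / n| ≤ C / n ^ 2 := by
  set B := |α| + |β| * Real.pi with hB
  have hB0 : 0 ≤ B := by positivity
  -- The argument is $z+u$ with $u=w/(n+\beta)$, $w=\alpha-\beta z$, $|w|\le B$. The threshold gives
  -- $n+\beta\ge n/2$ and $|u|\le 2B/n\le1$. The Taylor remainder contributes $4B^2$, and replacing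
  -- $w/(n+\beta)$ by $w/n$ contributes $2B|\beta|$.
  refine ⟨4 * B ^ 2 + 2 * B * |β|, 2 * |β| + 2 * B + 1, by positivity, fun n z hn hz hzπ => ?_⟩
  have hβ0 := abs_nonneg β
  have hn0 : 0 < n := by linarith
  have hnβ : n / 2 ≤ n + β := by linarith [neg_abs_le β]
  have hnβ0 : 0 < n + β := by linarith
  have hw : |α - β * z| ≤ B := by
    refine (abs_sub _ _).trans ?_
    rw [abs_mul, abs_of_nonneg hz, hB]
    gcongr
  set w := α - β * z with hwdef
  have hx : (n * z + α) / (n + β) = z + w / (n + β) := by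
    rw [hwdef]; field_simp; ring
  have hu : |w / (n + β)| ≤ 2 * B / n := by
    rw [abs_div, abs_of_pos hnβ0, div_le_div_iff₀ hnβ0 hn0]
    nlinarith [abs_nonneg w]
  have hu1 : |w / (n + β)| ≤ 1 := hu.trans (by rw [div_le_one hn0]; linarith)
  have h1 := abs_cos_add_sub_le (z := z) hu1
  have h2 : (w / (n + β)) ^ 2 ≤ 4 * B ^ 2 / n ^ 2 := by
    rw [← sq_abs]
    refine (pow_le_pow_left₀ (abs_nonneg _) hu 2).trans (le_of_eq ?_)
    ring
  have h3 : |w / n - w / (n + β)| ≤ 2 * B * |β| / n ^ 2 := by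
    rw [show w / n - w / (n + β) = (w / (n + β)) * β / n by field_simp; ring, abs_div, abs_mul,
      abs_of_pos hn0, div_le_div_iff₀ hn0 (by positivity)]
    have h4 : |w / (n + β)| * n ≤ 2 * B := by rwa [le_div_iff₀ hn0] at hu
    calc |w / (n + β)| * |β| * n ^ 2 = (|w / (n + β)| * n) * (|β| * n) := by ring
      _ ≤ (2 * B) * (|β| * n) := by gcongr
      _ = _ := by ring
  have h4 : |Real.sin z * (w / n - w / (n + β))| ≤ 2 * B * |β| / n ^ 2 := by
    rw [abs_mul]
    have := mul_le_mul (Real.abs_sin_le_one z) h3 (abs_nonneg _) zero_le_one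
    linarith
  rw [hx, show Real.cos (z + w / (n + β)) - Real.cos z + Real.sin z * w / n =
    (Real.cos (z + w / (n + β)) - Real.cos z + w / (n + β) * Real.sin z) +
      Real.sin z * (w / n - w / (n + β)) by ring, add_div]
  exact (abs_add_le _ _).trans (add_le_add (h1.trans h2) h4)

/-- Each term differs from the Riemann term by $O(n^{-2})$ uniformly in $k$, and there are at most
$n$ terms. -/
theorem tendsto_sum_abs_cos_sub_cos (α β α' β' : ℝ) {m : ℕ → ℕ} (hm : ∀ n, m n ≤ n) {c : ℝ}
    (hc : Tendsto (fun n => (m n : ℝ) / n) atTop (𝓝 c)) :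
    Tendsto (fun n : ℕ => ∑ k ∈ Finset.range (m n),
      |2 * Real.cos ((k * Real.pi + α) / (n + β)) - 2 * Real.cos ((k * Real.pi + α') / (n + β'))|)
      atTop (𝓝 (∫ t in (0 : ℝ)..c, 2 * |Real.sin (Real.pi * t) *
        ((α - α') - (β - β') * (Real.pi * t))|)) := by
  let g : ℝ → ℝ := fun t => 2 * |Real.sin (Real.pi * t) * ((α - α') - (β - β') * (Real.pi * t))|
  have hg : Continuous g := by fun_prop
  obtain ⟨C, N, hN, H⟩ := exists_abs_cos_div_sub_le α β
  obtain ⟨C', N', hN', H'⟩ := exists_abs_cos_div_sub_le α' β'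
  have h1 := tendsto_riemann_sum hg hm hc
  have hterm : ∀ n k : ℕ, max N N' ≤ n → k ≤ n →
      |(|2 * Real.cos ((k * Real.pi + α) / (n + β)) -
        2 * Real.cos ((k * Real.pi + α') / (n + β'))|) - g (k / n) / n| ≤
        2 * (C + C') / n ^ 2 := by
    intro n k hn hk
    have hn0 : (0 : ℝ) < n := by linarith [le_max_left N N']
    have hk' : (k : ℝ) / n ≤ 1 := by rw [div_le_one hn0]; exact_mod_cast hk
    have hz0 : 0 ≤ Real.pi * (k / n) := by positivity
    have hz1 : Real.pi * (k / n) ≤ Real.pi := by nlinarith [Real.pi_pos]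
    have e := H n _ ((le_max_left _ _).trans hn) hz0 hz1
    have e' := H' n _ ((le_max_right _ _).trans hn) hz0 hz1
    have hx : (n : ℝ) * (Real.pi * (k / n)) = k * Real.pi := by field_simp
    rw [hx] at e e'
    set z := Real.pi * ((k : ℝ) / n) with hz
    have hgz : g (k / n) / n = |2 * (Real.sin z * ((α - α') - (β - β') * z)) / n| := by
      simp only [g]
      rw [abs_div, abs_of_pos hn0, abs_mul 2, abs_two]
    -- The minus sign matches the first-order term of the cosine difference, so the absolute values
    -- can be compared directly.
    have hgz' : g (k / n) / n = |-(2 * (Real.sin z * ((α - α') - (β - β') * z)) / n)| := by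
      rw [abs_neg, hgz]
    rw [hgz']
    refine (abs_abs_sub_abs_le _ _).trans ?_
    rw [abs_le] at e e' ⊢
    have e1 : 2 * (C + C') / (n : ℝ) ^ 2 = 2 * (C / n ^ 2) + 2 * (C' / n ^ 2) := by ring
    have e2 : 2 * (Real.sin z * ((α - α') - (β - β') * z)) / n =
      2 * (Real.sin z * (α - β * z) / n) - 2 * (Real.sin z * (α' - β' * z) / n) := by ring
    rw [e1, e2]
    constructor <;> linarith [e.1, e.2, e'.1, e'.2]
  have h2 : Tendsto (fun n : ℕ => (∑ k ∈ Finset.range (m n),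
      |2 * Real.cos ((k * Real.pi + α) / (n + β)) -
        2 * Real.cos ((k * Real.pi + α') / (n + β'))|) -
      ∑ k ∈ Finset.range (m n), g (k / n) / n) atTop (𝓝 0) := by
    refine squeeze_zero_norm' ?_ (tendsto_const_div_atTop_nhds_zero_nat |2 * (C + C')|)
    filter_upwards [eventually_ge_atTop ⌈max N N'⌉₊] with n hn
    have hn1 : max N N' ≤ n := Nat.ceil_le.1 hn
    have hn0 : (0 : ℝ) < n := by linarith [le_max_left N N']
    rw [Real.norm_eq_abs, ← Finset.sum_sub_distrib]
    refine (Finset.abs_sum_le_sum_abs _ _).trans ((Finset.sum_le_sum (g := fun _ =>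
      |2 * (C + C')| / n ^ 2) fun k hk => (hterm n k hn1
        ((Finset.mem_range.1 hk).le.trans (hm n))).trans ?_).trans ?_)
    · gcongr
      exact le_abs_self _
    · rw [Finset.sum_const, Finset.card_range, nsmul_eq_mul, mul_div_assoc',
        div_le_div_iff₀ (by positivity) hn0]
      have : (m n : ℝ) ≤ n := by exact_mod_cast hm n
      calc (m n : ℝ) * |2 * (C + C')| * n ≤ n * |2 * (C + C')| * n := by gcongr
        _ = _ := by ring
  have h3 := h2.add h1
  simp only [sub_add_cancel, zero_add] at h3
  exact h3

theorem tendsto_div_of_abs_sub_le {a : ℕ → ℕ} {c D : ℝ} (h : ∀ n, |(a n : ℝ) - c * n| ≤ D) :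
    Tendsto (fun n => (a n : ℝ) / n) atTop (𝓝 c) := by
  rw [tendsto_iff_norm_sub_tendsto_zero]
  refine squeeze_zero' (.of_forall fun _ => norm_nonneg _) ?_
    (tendsto_const_div_atTop_nhds_zero_nat D)
  filter_upwards [eventually_gt_atTop 0] with n hn
  have hn' : (0 : ℝ) < n := by exact_mod_cast hn
  rw [Real.norm_eq_abs, show (a n : ℝ) / n - c = (a n - c * n) / n by field_simp, abs_div,
    abs_of_pos hn']
  gcongr
  exact h n

theorem tendsto_two_mul_cos_middle {a : ℕ → ℕ} {D : ℝ} (h : ∀ n, |(a n : ℝ) - 1 / 2 * n| ≤ D)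
    (α β : ℝ) : Tendsto (fun n : ℕ => |2 * Real.cos ((a n * Real.pi + α) / (n + β))|) atTop
      (𝓝 0) := by
  have h1 := tendsto_div_of_abs_sub_le h
  have h2 : Tendsto (fun n : ℕ => (a n * Real.pi + α) / (n + β)) atTop (𝓝 (Real.pi / 2)) := by
    have h3 : Tendsto (fun n : ℕ => ((a n : ℝ) / n * Real.pi + α / n) / (1 + β / n)) atTop
        (𝓝 ((1 / 2 * Real.pi + 0) / (1 + 0))) :=
      ((h1.mul_const _).add (tendsto_const_div_atTop_nhds_zero_nat α)).div
        (tendsto_const_nhds.add (tendsto_const_div_atTop_nhds_zero_nat β)) (by norm_num)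
    rw [show (1 / 2 * Real.pi + 0) / (1 + 0) = Real.pi / 2 by ring] at h3
    refine h3.congr' ?_
    filter_upwards [eventually_gt_atTop 0] with n hn
    have hn' : (n : ℝ) ≠ 0 := by exact_mod_cast hn.ne'
    rw [← mul_div_mul_right _ _ hn']
    congr 1 <;> field_simp
  have h3 : Tendsto (fun x : ℝ => |2 * Real.cos x|) (𝓝 (Real.pi / 2))
      (𝓝 |2 * Real.cos (Real.pi / 2)|) :=
    Continuous.tendsto (by fun_prop) _
  rw [Real.cos_pi_div_two, mul_zero, abs_zero] at h3
  exact h3.comp h2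

/-! ### The limiting integrals -/

theorem integral_abs_sin_mul_sub : ∫ t in (0 : ℝ)..(1 / 2), 2 * |Real.sin (Real.pi * t) *
    (Real.pi / 2 - 2 * (Real.pi * t))| = (4 - 4 * √2 + Real.pi) / Real.pi := by
  have hπ := Real.pi_pos
  -- Antiderivative of the integrand without absolute value, by parts. The sign changes at $t=1/4$,
  -- where the integral is split.
  let F : ℝ → ℝ := fun t => -2 * Real.cos (Real.pi * t) * (1 / 2 - 2 * t) -
    4 / Real.pi * Real.sin (Real.pi * t)
  have hF : ∀ t, HasDerivAt F
      (2 * (Real.sin (Real.pi * t) * (Real.pi / 2 - 2 * (Real.pi * t)))) t := by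
    intro t
    have h0 : HasDerivAt (fun t : ℝ => Real.pi * t) Real.pi t := by
      simpa using (hasDerivAt_id t).const_mul Real.pi
    have h1 : HasDerivAt (fun t : ℝ => 1 / 2 - 2 * t) (-2) t :=
      (((hasDerivAt_id t).const_mul (2 : ℝ)).const_sub (1 / 2)).congr_deriv (by norm_num)
    refine (((h0.cos.const_mul (-2)).mul h1).sub (h0.sin.const_mul (4 / Real.pi))).congr_deriv ?_
    field_simp
    ring
  have hcont : Continuous fun t : ℝ =>
      2 * |Real.sin (Real.pi * t) * (Real.pi / 2 - 2 * (Real.pi * t))| := by fun_prop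
  have hsin : ∀ t, 0 ≤ t → t ≤ 1 / 2 → 0 ≤ Real.sin (Real.pi * t) := fun t h0 h1 =>
    Real.sin_nonneg_of_nonneg_of_le_pi (by positivity) (by nlinarith)
  have h1 : ∫ t in (0 : ℝ)..(1 / 4), 2 * |Real.sin (Real.pi * t) *
      (Real.pi / 2 - 2 * (Real.pi * t))| = F (1 / 4) - F 0 := by
    rw [← intervalIntegral.integral_eq_sub_of_hasDerivAt (fun t _ => hF t)
      (Continuous.intervalIntegrable (by fun_prop) _ _)]
    refine intervalIntegral.integral_congr fun t ht => ?_
    rw [Set.uIcc_of_le (by norm_num)] at ht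
    have : 0 ≤ Real.pi / 2 - 2 * (Real.pi * t) := by nlinarith [ht.2]
    rw [abs_of_nonneg (mul_nonneg (hsin t ht.1 (by linarith [ht.2])) this)]
  have h2 : ∫ t in (1 / 4 : ℝ)..(1 / 2), 2 * |Real.sin (Real.pi * t) *
      (Real.pi / 2 - 2 * (Real.pi * t))| = -(F (1 / 2) - F (1 / 4)) := by
    rw [← intervalIntegral.integral_eq_sub_of_hasDerivAt (fun t _ => hF t)
      (Continuous.intervalIntegrable (by fun_prop) _ _), ← intervalIntegral.integral_neg]
    refine intervalIntegral.integral_congr fun t ht => ?_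
    rw [Set.uIcc_of_le (by norm_num)] at ht
    have : Real.pi / 2 - 2 * (Real.pi * t) ≤ 0 := by nlinarith [ht.1]
    rw [abs_of_nonpos (mul_nonpos_of_nonneg_of_nonpos (hsin t (by linarith [ht.1]) ht.2) this)]
    ring
  rw [← intervalIntegral.integral_add_adjacent_intervals (hcont.intervalIntegrable 0 (1 / 4))
    (hcont.intervalIntegrable (1 / 4) (1 / 2)), h1, h2]
  have e1 : Real.pi * (1 / 4) = Real.pi / 4 := by ring
  have e2 : Real.pi * (1 / 2) = Real.pi / 2 := by ring
  simp only [F, e1, e2, mul_zero, Real.sin_zero, Real.cos_zero, Real.sin_pi_div_four,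
    Real.sin_pi_div_two, Real.cos_pi_div_two]
  field_simp
  ring

theorem integral_abs_sin_add_integral_abs_sin :
    (∫ t in (0 : ℝ)..(1 / 2), 2 * |Real.sin (Real.pi * t) *
      ((0 - Real.pi / 4) - (0 - -(1 / 2)) * (Real.pi * t))|) +
    (∫ t in (0 : ℝ)..(1 / 2), 2 * |Real.sin (Real.pi * t) *
      ((Real.pi - 3 * Real.pi / 4) - (0 - -(1 / 2)) * (Real.pi * t))|) = 1 := by
  have hπ := Real.pi_pos
  rw [← intervalIntegral.integral_add (Continuous.intervalIntegrable (by fun_prop) _ _)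
    (Continuous.intervalIntegrable (by fun_prop) _ _)]
  have hF : ∀ t, HasDerivAt (fun t => -Real.cos (Real.pi * t))
      (Real.pi * Real.sin (Real.pi * t)) t := by
    intro t
    have h0 : HasDerivAt (fun t : ℝ => Real.pi * t) Real.pi t := by
      simpa using (hasDerivAt_id t).const_mul Real.pi
    exact h0.cos.neg.congr_deriv (by ring)
  have h1 := intervalIntegral.integral_eq_sub_of_hasDerivAt (a := 0) (b := 1 / 2)
    (fun t _ => hF t) (Continuous.intervalIntegrable (by fun_prop) _ _)
  rw [show Real.pi * (1 / 2) = Real.pi / 2 by ring, Real.cos_pi_div_two, mul_zero,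
    Real.cos_zero] at h1
  rw [show -0 - -1 = (1 : ℝ) by norm_num] at h1
  refine Eq.trans ?_ h1
  refine intervalIntegral.integral_congr fun t ht => ?_
  rw [Set.uIcc_of_le (by norm_num)] at ht
  have hs : 0 ≤ Real.sin (Real.pi * t) :=
    Real.sin_nonneg_of_nonneg_of_le_pi (mul_nonneg hπ.le ht.1) (by nlinarith [ht.2])
  have ht0 : 0 ≤ Real.pi * t := mul_nonneg hπ.le ht.1
  -- On $[0,1/2]$ the factors are $-(\pi/4+\pi t/2)\le0$ and $\pi/4-\pi t/2\ge0$; their absolute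
  -- values sum to the constant $\pi/2$.
  rw [abs_of_nonpos (mul_nonpos_of_nonneg_of_nonpos hs (by linarith)),
    abs_of_nonneg (mul_nonneg hs (by nlinarith [ht.2]))]
  ring

/-! ### Passage to the limit for each pair of graphs -/

theorem abs_half_sub_le (n : ℕ) : |((n / 2 : ℕ) : ℝ) - 1 / 2 * n| ≤ 1 := by
  have h1 : 2 * ((n / 2 : ℕ) : ℝ) ≤ n := by exact_mod_cast Nat.mul_div_le n 2
  have h2 : (n : ℝ) ≤ 2 * (n / 2 : ℕ) + 1 := by exact_mod_cast (by omega : n ≤ 2 * (n / 2) + 1)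
  rw [abs_le]; constructor <;> linarith

theorem abs_half_succ_sub_le (n : ℕ) : |(((n + 1) / 2 : ℕ) : ℝ) - 1 / 2 * n| ≤ 1 := by
  have h1 : 2 * (((n + 1) / 2 : ℕ) : ℝ) ≤ n + 1 := by
    exact_mod_cast Nat.mul_div_le (n + 1) 2
  have h2 : (n : ℝ) ≤ 2 * ((n + 1) / 2 : ℕ) := by exact_mod_cast (by omega : n ≤ 2 * ((n + 1) / 2))
  rw [abs_le]; constructor <;> linarith

theorem abs_half_pred_sub_le (n : ℕ) : |(((n - 1) / 2 : ℕ) : ℝ) - 1 / 2 * n| ≤ 1 := by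
  have h1 : 2 * (((n - 1) / 2 : ℕ) : ℝ) ≤ n := by
    exact_mod_cast (by omega : 2 * ((n - 1) / 2) ≤ n)
  have h2 : (n : ℝ) ≤ 2 * ((n - 1) / 2 : ℕ) + 2 := by
    exact_mod_cast (by omega : n ≤ 2 * ((n - 1) / 2) + 2)
  rw [abs_le]; constructor <;> linarith

theorem abs_pred_half_sub_le (n : ℕ) : |((n / 2 - 1 : ℕ) : ℝ) - 1 / 2 * n| ≤ 2 := by
  have h1 : 2 * ((n / 2 - 1 : ℕ) : ℝ) ≤ n := by exact_mod_cast (by omega : 2 * (n / 2 - 1) ≤ n)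
  have h2 : (n : ℝ) ≤ 2 * (n / 2 - 1 : ℕ) + 3 := by
    exact_mod_cast (by omega : n ≤ 2 * (n / 2 - 1) + 3)
  rw [abs_le]; constructor <;> linarith

theorem sum_range_even_add_odd (F : ℕ → ℝ) (M : ℕ) : ∑ k ∈ Finset.range M, F k =
    (∑ j ∈ Finset.range ((M + 1) / 2), F (2 * j)) + ∑ j ∈ Finset.range (M / 2), F (2 * j + 1) := by
  induction M with
  | zero => simp
  | succ M ih =>
    rw [Finset.sum_range_succ, ih]
    rcases Nat.even_or_odd' M with ⟨a, rfl | rfl⟩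
    · rw [show (2 * a + 1 + 1) / 2 = a + 1 by omega, show (2 * a + 1) / 2 = a by omega,
        show 2 * a / 2 = a by omega, Finset.sum_range_succ]
      ring
    · rw [show (2 * a + 1 + 1 + 1) / 2 = a + 1 by omega, show (2 * a + 1 + 1) / 2 = a + 1 by omega,
        show (2 * a + 1) / 2 = a by omega, Finset.sum_range_succ (fun j => F (2 * j + 1))]
      ring

theorem integral_eq_of_abs_eq_mul {f : ℝ → ℝ} {r : ℝ}
    (h : ∀ t, |f t| = r * |Real.sin (Real.pi * t) * (Real.pi / 2 - 2 * (Real.pi * t))|) :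
    ∫ t in (0 : ℝ)..(1 / 2), 2 * |f t| = r * ((4 - 4 * √2 + Real.pi) / Real.pi) := by
  rw [← integral_abs_sin_mul_sub, ← intervalIntegral.integral_const_mul]
  refine intervalIntegral.integral_congr fun t _ => ?_
  simp only [h]
  ring

theorem tendsto_sigmaPZ (hn : ∀ n, 4 ≤ n + 4) :
    Tendsto (fun n : ℕ => sigmaPZ (n + 4) (hn n)) atTop
    (𝓝 ((8 - 8 * √2 + 2 * Real.pi) / Real.pi)) := by
  have h := (tendsto_sum_abs_cos_sub_cos Real.pi 1 (Real.pi / 2) (-1) (m := fun n => n / 2)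
    (fun n => Nat.div_le_self n 2) (tendsto_div_of_abs_sub_le abs_half_sub_le)).const_mul 2
  rw [integral_eq_of_abs_eq_mul (r := 1) fun t => by rw [one_mul]; congr 1; ring] at h
  rw [show 2 * (1 * ((4 - 4 * √2 + Real.pi) / Real.pi)) =
    (8 - 8 * √2 + 2 * Real.pi) / Real.pi by ring] at h
  simp only [sigmaPZ_eq]
  exact h.comp (tendsto_add_atTop_nat 4)

theorem tendsto_ite_parity {F : ℕ → ℝ} (hF : Tendsto F atTop (𝓝 0)) :
    Tendsto (fun n => if n % 2 = 0 then F n else 0) atTop (𝓝 0) :=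
  squeeze_zero_norm (a := fun n => ‖F n‖) (fun n => by split_ifs <;> simp)
    (tendsto_zero_iff_norm_tendsto_zero.1 hF)

theorem tendsto_sigmaWZ (hn : ∀ n, 6 ≤ n + 6) :
    Tendsto (fun n : ℕ => sigmaWZ (n + 6) (hn n)) atTop
    (𝓝 ((8 - 8 * √2 + 2 * Real.pi) / Real.pi)) := by
  have h := ((tendsto_sum_abs_cos_sub_cos 0 (-3) (Real.pi / 2) (-1) (m := fun n => (n - 1) / 2)
    (fun n => by omega) (tendsto_div_of_abs_sub_le abs_half_pred_sub_le)).add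
    (tendsto_ite_parity
      (tendsto_two_mul_cos_middle abs_pred_half_sub_le (Real.pi / 2) (-1)))).const_mul 2
  rw [integral_eq_of_abs_eq_mul (r := 1) fun t => by rw [one_mul, ← abs_neg]; congr 1; ring] at h
  rw [show 2 * (1 * ((4 - 4 * √2 + Real.pi) / Real.pi) + 0) =
    (8 - 8 * √2 + 2 * Real.pi) / Real.pi by ring] at h
  simp only [sigmaWZ_eq]
  exact h.comp (tendsto_add_atTop_nat 6)

theorem tendsto_sigmaPW (hn : ∀ n, 6 ≤ n + 6) :
    Tendsto (fun n : ℕ => sigmaPW (n + 6) (hn n)) atTop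
    (𝓝 (2 * ((8 - 8 * √2 + 2 * Real.pi) / Real.pi))) := by
  have h := ((tendsto_sum_abs_cos_sub_cos Real.pi 1 0 (-3) (m := fun n => (n - 1) / 2)
    (fun n => by omega) (tendsto_div_of_abs_sub_le abs_half_pred_sub_le)).add
    (tendsto_ite_parity
      (tendsto_two_mul_cos_middle abs_pred_half_sub_le Real.pi 1))).const_mul 2
  rw [integral_eq_of_abs_eq_mul (r := 2) fun t => by
    rw [← abs_two, ← abs_mul, abs_two]; congr 1; ring] at h
  rw [show 2 * (2 * ((4 - 4 * √2 + Real.pi) / Real.pi) + 0) =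
    2 * ((8 - 8 * √2 + 2 * Real.pi) / Real.pi) by ring] at h
  simp only [sigmaPW_eq]
  exact h.comp (tendsto_add_atTop_nat 6)

/-- With $M=n+2$, halving numerator and denominator puts the angles in the form
$(j\pi+\alpha)/(M+\beta)$. For $k=2j$ the cycle has $(0,0)$ and $Z_{2M}$ has $(\pi/4,-1/2)$; for
$k=2j+1$ they have $(\pi,0)$ and $(3\pi/4,-1/2)$. -/
theorem tendsto_sigmaCZ (hn : ∀ n, 4 ≤ 2 * (n + 2)) :
    Tendsto (fun n : ℕ => sigmaCZ (2 * (n + 2)) (hn n)) atTop (𝓝 2) := by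
  have h := ((tendsto_sum_abs_cos_sub_cos 0 0 (Real.pi / 4) (-(1 / 2)) (m := fun n => (n + 1) / 2)
    (fun n => by omega) (tendsto_div_of_abs_sub_le abs_half_succ_sub_le)).add
    (tendsto_sum_abs_cos_sub_cos Real.pi 0 (3 * Real.pi / 4) (-(1 / 2)) (m := fun n => n / 2)
    (fun n => by omega) (tendsto_div_of_abs_sub_le abs_half_sub_le))).const_mul 2
  rw [integral_abs_sin_add_integral_abs_sin, mul_one] at h
  simp only [sigmaCZ_eq]
  refine (h.comp (tendsto_add_atTop_nat 2)).congr fun n => ?_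
  simp only [Function.comp_apply]
  rw [sum_range_even_add_odd _ (n + 2)]
  have hpos : (2 * ((n + 2 : ℕ) : ℝ) + -1) ≠ 0 := by
    push_cast
    exact ne_of_gt (by linarith [n.cast_nonneg (α := ℝ)])
  have hpos' : (((n + 2 : ℕ) : ℝ) + -(1 / 2)) ≠ 0 := fun h0 => hpos (by linarith)
  have hn0 : ((n + 2 : ℕ) : ℝ) ≠ 0 := by positivity
  congr 2
  all_goals
    refine Finset.sum_congr rfl fun j _ => ?_
    congr 3
  · congr 1
    rw [show (2 * j + 1) / 2 = j by omega, Nat.cast_mul, Nat.cast_two]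
    field_simp
    ring
  · congr 1
    rw [Nat.cast_mul, Nat.cast_mul, Nat.cast_two, div_eq_div_iff hpos' hpos]
    ring
  · congr 1
    rw [show (2 * j + 1 + 1) / 2 = j + 1 by omega, Nat.cast_mul, Nat.cast_two, Nat.cast_succ j]
    field_simp
    ring
  · congr 1
    rw [Nat.cast_succ (2 * j), Nat.cast_mul, Nat.cast_mul, Nat.cast_two, div_eq_div_iff hpos' hpos]
    ring

theorem abs_limit_sub_lt : |(8 - 8 * √2 + 2 * Real.pi) / Real.pi - 0.945| < 0.0005 := by
  have h1 := Real.pi_gt_d4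
  have h2 := Real.pi_lt_d4
  have h3 : (1.41421 : ℝ) < √2 := by rw [Real.lt_sqrt (by norm_num)]; norm_num
  have h4 : √2 < (1.41422 : ℝ) := by rw [Real.sqrt_lt' (by norm_num)]; norm_num
  rw [abs_lt, sub_eq_add_neg]
  constructor
  · rw [← sub_lt_iff_lt_add, lt_div_iff₀ Real.pi_pos]
    linarith
  · rw [← lt_sub_iff_add_lt, div_lt_iff₀ Real.pi_pos]
    linarith

theorem theorem1p1 :
    Tendsto (fun n : ℕ => sigmaCZ (2 * (n + 2)) (by omega)) atTop (𝓝 2) ∧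
    Tendsto (fun n : ℕ => sigmaPZ (n + 4) (by omega)) atTop
      (𝓝 ((8 - 8 * √2 + 2 * Real.pi) / Real.pi)) ∧
    Tendsto (fun n : ℕ => sigmaWZ (n + 6) (by omega)) atTop
      (𝓝 ((8 - 8 * √2 + 2 * Real.pi) / Real.pi)) ∧
    (∃ L : ℝ, Tendsto (fun n : ℕ => sigmaPW (n + 6) (by omega)) atTop (𝓝 L) ∧
      1 / 2 * L = (8 - 8 * √2 + 2 * Real.pi) / Real.pi) ∧
    |(8 - 8 * √2 + 2 * Real.pi) / Real.pi - 0.945| < 0.0005 :=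
  ⟨tendsto_sigmaCZ _, tendsto_sigmaPZ _, tendsto_sigmaWZ _, ⟨_, tendsto_sigmaPW _, by ring⟩,
    abs_limit_sub_lt⟩
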